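/- **Conventions.** Manifolds are smooth, Hausdorff, second countable and without boundary. An *orbifold chart* of dimension $n$ on a topological space $Q$ is a triple $(V,G,\pi)$ where $V$ is a connected non-empty $n$-manifold, $G$ is a finite subgroup of $\mathrm{Diff}(V)$ and $\pi\colon V\to Q$ has open image and induces a homeomorphism $G\backslash V\to\pi(V)$. Charts $(V,G,\pi)$, $(W,H,\chi)$ are *compatible* if for all $x\in V$, $y\in W$ with $\pi(x)=\chi(y)$ there is a diffeomorphism $h$ from a connected open neighbourhood of $x$ onto an open neighbourhood of $y$ with $h(x)=y$ and $\chi\circ h=\pi$. An *orbifold atlas* is a set of pairwise compatible charts (of dimension $n$) whose images cover $Q$; an *orbifold structure* $\mathcal U$ is a maximal orbifold atlas, and a *representative* of $\mathcal U$ is an orbifold atlas $\mathcal V\subseteq\mathcal U$. An *open embedding* of charts $(W,H,\chi)\to(V,G,\pi)$ is a diffeomorphism $\mu$ of $W$ onto an open subset of $V$ with $\pi\circ\mu=\chi$. (Orbifolds are usually required to have a Hausdorff, second countable underlying space $Q$; this is not needed below.) For a set $\mathcal V=\{(V_i,G_i,\pi_i)\}_{i\in I}$ of pairwise distinct charts let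 $V=\coprod_i V_i$ and $\pi=\coprod_i\pi_i\colon V\to Q$. A *transition* on $V$ is a diffeomorphism $f\colon\operatorname{dom}f\to\operatorname{cod}f$ between open subsets of $V$, and $\Psi(\mathcal V)$ is the set of the transitions $f$ on $V$ with $\pi\circ f=\pi|_{\operatorname{dom}f}$. A *change of charts* of $\mathcal V$ is an $f\in\Psi(\mathcal V)$ with connected non-empty domain, contained in one $V_i$, and codomain contained in one $V_j$. The *atlas groupoid* $\Gamma(\mathcal V)$ is the étale Lie groupoid with objects $V$ and arrows the germs $\operatorname{germ}_x f$, $f\in\Psi(\mathcal V)$, $x\in\operatorname{dom}f$, with source $x$, target $f(x)$, composition, units and inverses those of germs, and with the germ topology and differential structure (for each $f\in\Psi(\mathcal V)$ the set of its germs is open and $\operatorname{germ}_xf\mapsto x$ is a diffeomorphism from it onto $\operatorname{dom}f$). If $\mathcal V$ is an orbifold atlas of $Q$, write $\alpha_{\mathcal V}\colon|\Gamma(\mathcal V)|\to Q$, $[x]\mapsto\pi(x)$, for the canonical bijection from the orbit space. A *homomorphism* $\varphi=(\varphi_0,\varphi_1)\colon\Gamma(\mathcal V)\to\Gamma(\mathcal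 V')$ is a pair of smooth maps on objects and arrows that commutes with all structure maps; $|\varphi|$ is the induced map of orbit spaces. A *quasi-pseudogroup* is a set $P$ of transitions such that (i) for $f\in P$ and $x\in\operatorname{dom}f$ some $g\in P$ has the same germ at $f(x)$ as $f^{-1}$, and (ii) for $f,g\in P$ and $x\in\operatorname{dom}f$ with $f(x)\in\operatorname{dom}g$ some $h\in P$ has the same germ at $x$ as $g\circ f$. A set $A$ of transitions that is closed under composition, inversion and restriction to open subsets, and contains every transition whose restrictions to the members of some open cover of its domain lie in $A$, is *generated* by a set $B\subseteq A$ if each germ of an element of $A$ is a germ of an element of $B$; $B$ *generates* $A$ if $A$ is the only such set generated by $B$. Let $\mathcal U$, $\mathcal U'$ be orbifold structures on $Q$, $Q'$, let $\mathcal V=\{(V_i,G_i,\pi_i)\mid i\in I\}$ be a representative of $\mathcal U$ (indexed by $I$) and $\mathcal V'$ a representative of $\mathcal U'$. A *representative of an orbifold map* with domain atlas $\mathcal V$ and range family in $\mathcal V'$ is a tuple $\hat f=(f,\{\tilde f_i\}_{i\in I},P,\nu)$ where * $f\colon Q\to Q'$ is continuous; * each $\tilde f_i\colon V_i\to V'_i$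 is a smooth map to the manifold of a chart $(V_i',G_i',\pi_i')\in\mathcal V'$, which is part of the data, with $\pi'_i\circ\tilde f_i=f\circ\pi_i$; put $\psi=\coprod_i\tilde f_i\colon\coprod_i V_i\to\coprod_{\mathcal V'}V'_j\subseteq\coprod_{\mathcal U'}W'$; * $P$ is a quasi-pseudogroup that consists of changes of charts of $\mathcal V$ and generates $\Psi(\mathcal V)$; * $\nu\colon P\to\Psi(\mathcal U')$ assigns to each $\lambda\in P$ an open embedding between orbifold charts in $\mathcal U'$ (the domain of $\nu(\lambda)$ is an open subset of one chart in $\mathcal U'$ which, with the restricted projection and a suitable group, is itself an orbifold chart in $\mathcal U'$, and $\nu(\lambda)$ maps it into one chart in $\mathcal U'$) such that (a) $\psi(\operatorname{dom}\lambda)\subseteq\operatorname{dom}\nu(\lambda)$ and $\psi\circ\lambda=\nu(\lambda)\circ\psi|_{\operatorname{dom}\lambda}$; (b) $\operatorname{germ}_x\lambda=\operatorname{germ}_x\mu$ implies $\operatorname{germ}_{\psi(x)}\nu(\lambda)=\operatorname{germ}_{\psi(x)}\nu(\mu)$ for $\lambda,\mu\in P$, $x\in\operatorname{dom}\lambda\cap\operatorname{dom}\mu$;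 (c) if $\lambda,\mu,h\in P$, $x\in\operatorname{dom}\lambda\cap\operatorname{dom}h$, $\lambda(x)\in\operatorname{dom}\mu$ and $\mu\circ\lambda=h$ near $x$, then $\operatorname{germ}_{\psi(\lambda(x))}\nu(\mu)\cdot\operatorname{germ}_{\psi(x)}\nu(\lambda)=\operatorname{germ}_{\psi(x)}\nu(h)$; (d) if $\lambda\in P$ is the identity near $x\in\operatorname{dom}\lambda$, then $\operatorname{germ}_{\psi(x)}\nu(\lambda)=\operatorname{germ}_{\psi(x)}\mathrm{id}$. Two such tuples $(f,\{\tilde f_i\},P_1,\nu_1)$ and $(g,\{\tilde g_i\},P_2,\nu_2)$ are *equivalent* if $f=g$, $\tilde f_i=\tilde g_i$ for all $i$ (with the same range charts), and $\operatorname{germ}_{\psi(x)}\nu_1(\lambda_1)=\operatorname{germ}_{\psi(x)}\nu_2(\lambda_2)$ for all $\lambda_1\in P_1$, $\lambda_2\in P_2$ and $x\in\operatorname{dom}\lambda_1\cap\operatorname{dom}\lambda_2$ with $\operatorname{germ}_x\lambda_1=\operatorname{germ}_x\lambda_2$. This is an equivalence relation; $\mathrm{Orbmap}(\mathcal V,\mathcal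 V')$ is the set of equivalence classes, and $\mathrm{Hom}(\Gamma(\mathcal V),\Gamma(\mathcal V'))$ is the set of homomorphisms. **Proposition.** There are maps $$F_1\colon\mathrm{Orbmap}(\mathcal V,\mathcal V')\to\mathrm{Hom}(\Gamma(\mathcal V),\Gamma(\mathcal V')),\qquad F_2\colon\mathrm{Hom}(\Gamma(\mathcal V),\Gamma(\mathcal V'))\to\mathrm{Orbmap}(\mathcal V,\mathcal V')$$ such that 1. for every representative $\hat f=(f,\{\tilde f_i\},P,\nu)$, $F_1([\hat f])$ is the unique homomorphism $\varphi$ with $\varphi_0=\coprod_i\tilde f_i$ and $\varphi_1(\operatorname{germ}_x\lambda)=\operatorname{germ}_{\varphi_0(x)}\nu(\lambda)$ for all $\lambda\in P$, $x\in\operatorname{dom}\lambda$; 2. for every homomorphism $\varphi$, $F_2(\varphi)$ is the class consisting of exactly those representatives $(f,\{\tilde f_i\},P,\nu)$ with $f=\alpha_{\mathcal V'}\circ|\varphi|\circ\alpha_{\mathcal V}^{-1}$, $\tilde f_i=\varphi_0|_{V_i}$ for all $i$, and $\varphi_1(\operatorname{germ}_x\lambda)=\operatorname{germ}_{\varphi_0(x)}\nu(\lambda)$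 for all $\lambda\in P$, $x\in\operatorname{dom}\lambda$; and $F_1$ and $F_2$ are bijections inverse to each other. -/

import Mathlib

open Set Filter Topology
open scoped Manifold ContDiff

noncomputable section

namespace OrbGpd

universe u v

/-! ### Reduced orbifolds -/

/-- A (reduced) orbifold chart `(V, G, π)` of dimension `n` on `Q`: a connected smooth
`n`-manifold `V` (Hausdorff, second countable), a finite group `G` of diffeomorphisms of `V`, and a
map `π : V → Q` with open image inducing a homeomorphism `G \ V → π(V)`. Since `G` contains the
inverses of its elements, a group of smooth bijections is a group of diffeomorphisms. -/
structure OrbChart (n : ℕ) (Q : Type v) [TopologicalSpace Q] where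
  /-- the manifold `V` -/
  carrier : Type u
  [top : TopologicalSpace carrier]
  [charted : ChartedSpace (EuclideanSpace ℝ (Fin n)) carrier]
  [manifold : IsManifold (𝓡 n) ∞ carrier]
  [t2 : T2Space carrier]
  [secondCountable : SecondCountableTopology carrier]
  [connected : ConnectedSpace carrier]
  /-- the group `G`, acting faithfully on `V` -/
  group : Subgroup (Equiv.Perm carrier)
  group_finite : Finite group
  group_smooth : ∀ g ∈ group, ContMDiff (𝓡 n) (𝓡 n) ∞ (g : carrier → carrier)
  /-- the projection `π` -/
  proj : carrier → Q
  isOpen_range : IsOpen (range proj)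
  homeo : ∃ h : Quotient (MulAction.orbitRel group carrier) ≃ₜ range proj,
    ∀ x, (h (Quotient.mk _ x) : Q) = proj x

attribute [instance] OrbChart.top OrbChart.charted OrbChart.manifold OrbChart.t2
  OrbChart.secondCountable OrbChart.connected

/-- `f` restricts to a diffeomorphism between the open sets `f.source` and `f.target`. -/
def IsDiffeo (n : ℕ) {M N : Type*} [TopologicalSpace M] [TopologicalSpace N]
    [ChartedSpace (EuclideanSpace ℝ (Fin n)) M] [ChartedSpace (EuclideanSpace ℝ (Fin n)) N]
    (f : OpenPartialHomeomorph M N) : Prop :=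
  ContMDiffOn (𝓡 n) (𝓡 n) ∞ f f.source ∧ ContMDiffOn (𝓡 n) (𝓡 n) ∞ f.symm f.target

section Charts

variable {n : ℕ} {Q : Type v} [TopologicalSpace Q]

/-- Two orbifold charts are compatible if any two points over the same point of `Q` are related by
a diffeomorphism of connected open neighbourhoods commuting with the projections. -/
def Compatible (c d : OrbChart.{u} n Q) : Prop :=
  ∀ (x : c.carrier) (y : d.carrier), c.proj x = d.proj y →
    ∃ h : OpenPartialHomeomorph c.carrier d.carrier, IsDiffeo n h ∧ IsConnected h.source ∧
      x ∈ h.source ∧ h x = y ∧ ∀ z ∈ h.source, d.proj (h z) = c.proj z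

/-- An open embedding of orbifold charts: a diffeomorphism onto an open subset which commutes with
the projections. -/
def IsChartEmbedding (c d : OrbChart.{u} n Q) (μ : c.carrier → d.carrier) : Prop :=
  Function.Injective μ ∧ IsLocalDiffeomorph (𝓡 n) (𝓡 n) ∞ μ ∧ ∀ x, d.proj (μ x) = c.proj x

/-- An orbifold atlas: a set of pairwise compatible orbifold charts covering `Q`. -/
def IsAtlas (V : Set (OrbChart.{u} n Q)) : Prop :=
  (∀ c ∈ V, ∀ d ∈ V, Compatible c d) ∧ ∀ q : Q, ∃ c ∈ V, q ∈ range c.proj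

variable (n Q) in
/-- An orbifold structure `𝒰` on `Q`: a maximal orbifold atlas. -/
structure OrbStructure where
  charts : Set (OrbChart.{u} n Q)
  isAtlas : IsAtlas charts
  maximal : ∀ c : OrbChart.{u} n Q, (∀ d ∈ charts, Compatible c d) → c ∈ charts

/-- `V` is a representative of the orbifold structure `𝒰`: an orbifold atlas contained in it. -/
def IsRepresentative (V : Set (OrbChart.{u} n Q)) (𝒰 : OrbStructure.{u} n Q) : Prop :=
  IsAtlas V ∧ V ⊆ 𝒰.charts

/-! ### The disjoint union of the charts of a family -/

/-- The disjoint union `∐ V_i` of the charts in `V`. The family is indexed by its own elements. -/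
abbrev Total (V : Set (OrbChart.{u} n Q)) : Type _ := Σ c : V, c.1.carrier

/-- The projection `π = ∐ π_i`. -/
def Total.proj {V : Set (OrbChart.{u} n Q)} (x : Total V) : Q := x.1.1.proj x.2

/-- The inclusion of disjoint unions given by an inclusion of families of charts. -/
def Total.incl {V W : Set (OrbChart.{u} n Q)} (h : V ⊆ W) (x : Total V) : Total W :=
  ⟨⟨x.1.1, h x.1.2⟩, x.2⟩

/-- The smooth structure of the disjoint union: the charts are those of the components. -/
instance Total.chartedSpace (V : Set (OrbChart.{u} n Q)) :
    ChartedSpace (EuclideanSpace ℝ (Fin n)) (Total V) where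
  atlas := {e | ∃ (c : V) (e' : OpenPartialHomeomorph c.1.carrier (EuclideanSpace ℝ (Fin n))),
    e' ∈ atlas (EuclideanSpace ℝ (Fin n)) c.1.carrier ∧
      e = e'.lift_openEmbedding (X' := Total V) IsOpenEmbedding.sigmaMk}
  chartAt x := (chartAt (EuclideanSpace ℝ (Fin n)) x.2).lift_openEmbedding (X' := Total V)
    (f := Sigma.mk x.1) IsOpenEmbedding.sigmaMk
  mem_chart_source x := ⟨x.2, mem_chart_source _ _, rfl⟩
  chart_mem_atlas x := ⟨x.1, _, chart_mem_atlas _ _, rfl⟩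

instance Total.isManifold (V : Set (OrbChart.{u} n Q)) : IsManifold (𝓡 n) ∞ (Total V) where
  compatible {e e'} he he' := by
    obtain ⟨c, f, hf, rfl⟩ := he
    obtain ⟨d, g, hg, rfl⟩ := he'
    by_cases hcd : c = d
    · subst hcd
      rw [f.lift_openEmbedding_trans g]
      exact c.1.manifold.compatible hf hg
    · apply ContDiffGroupoid.mem_of_source_eq_empty
      ext x
      refine ⟨fun ⟨_, hx⟩ ↦ ?_, fun hx ↦ hx.elim⟩
      obtain ⟨z, _, hz⟩ := hx
      exact hcd (congrArg Sigma.fst hz).symm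

end Charts

/-! ### Transitions and pseudogroups

A transition on `M` is a diffeomorphism between open subsets of `M`. It is given by an
`OpenPartialHomeomorph M M`, whose values outside its source carry no meaning: two of these are the
same transition iff they are related by `≈` (same source, same values on it). -/

section Pseudogroups

variable {M : Type*} [TopologicalSpace M]

/-- A pseudogroup of transitions on `M` which is closed under restrictions and has the gluing
property. -/
structure IsGluingPseudogroup (n : ℕ) [ChartedSpace (EuclideanSpace ℝ (Fin n)) M]
    (A : Set (OpenPartialHomeomorph M M)) : Prop where
  diffeo : ∀ f ∈ A, IsDiffeo n f
  congr : ∀ f ∈ A, ∀ g, f ≈ g → g ∈ A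
  trans : ∀ f ∈ A, ∀ g ∈ A, f.trans g ∈ A
  symm : ∀ f ∈ A, f.symm ∈ A
  restr : ∀ f ∈ A, ∀ (s : Set M) (hs : IsOpen s), f.restrOpen s hs ∈ A
  glue : ∀ f : OpenPartialHomeomorph M M, IsDiffeo n f →
    (∀ x ∈ f.source, ∃ (s : Set M) (hs : IsOpen s), x ∈ s ∧ f.restrOpen s hs ∈ A) → f ∈ A

/-- The pseudogroup `A` is generated by the set `B` of transitions. -/
def IsGeneratedBy (A B : Set (OpenPartialHomeomorph M M)) : Prop :=
  B ⊆ A ∧ ∀ f ∈ A, ∀ x ∈ f.source, ∃ g ∈ B, x ∈ g.source ∧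
    ∃ s : Set M, IsOpen s ∧ x ∈ s ∧ s ⊆ f.source ∩ g.source ∧ EqOn f g s

/-- `B` generates `A`: it is the only pseudogroup with the gluing property and closed under
restrictions that is generated by `B`. -/
def Generates (n : ℕ) [ChartedSpace (EuclideanSpace ℝ (Fin n)) M]
    (B A : Set (OpenPartialHomeomorph M M)) : Prop :=
  IsGluingPseudogroup n A ∧ IsGeneratedBy A B ∧
    ∀ A' : Set (OpenPartialHomeomorph M M), IsGluingPseudogroup n A' → IsGeneratedBy A' B → A' = A

/-- A quasi-pseudogroup on `M`: a set of transitions that is closed under inversion and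
composition on the level of germs. -/
structure IsQuasiPseudogroup (n : ℕ) [ChartedSpace (EuclideanSpace ℝ (Fin n)) M]
    (P : Set (OpenPartialHomeomorph M M)) : Prop where
  diffeo : ∀ f ∈ P, IsDiffeo n f
  inv : ∀ f ∈ P, ∀ x ∈ f.source, ∃ (s : Set M) (hs : IsOpen s), x ∈ s ∧ s ⊆ f.source ∧
    ∃ g ∈ P, ∃ (t : Set M) (ht : IsOpen t), f x ∈ t ∧ t ⊆ g.source ∧
      (f.restrOpen s hs).symm ≈ g.restrOpen t ht
  comp : ∀ f ∈ P, ∀ g ∈ P, ∀ x ∈ f.source, f x ∈ g.source → ∃ h ∈ P, x ∈ h.source ∧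
    ∃ s : Set M, IsOpen s ∧ x ∈ s ∧ s ⊆ (f.trans g).source ∩ h.source ∧ EqOn (g ∘ f) h s

end Pseudogroups

section AtlasGroupoid

variable {n : ℕ} {Q : Type v} [TopologicalSpace Q]

/-- The pseudogroup `Ψ(V)` of the transitions `f` on `∐ V_i` with `π ∘ f = π` on `dom f`. -/
def Psi (V : Set (OrbChart.{u} n Q)) : Set (OpenPartialHomeomorph (Total V) (Total V)) :=
  {f | IsDiffeo n f ∧ ∀ x ∈ f.source, (f x).proj = x.proj}

/-- `f` is a change of charts of the family `V`: an element of `Ψ(V)` between connected open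
subsets of two members of `V`. -/
def IsChangeOfCharts (V : Set (OrbChart.{u} n Q))
    (f : OpenPartialHomeomorph (Total V) (Total V)) : Prop :=
  f ∈ Psi V ∧ IsConnected f.source ∧
    ∃ c d : V, (∀ x ∈ f.source, x.1 = c) ∧ ∀ y ∈ f.target, y.1 = d

theorem refl_mem_Psi (V : Set (OrbChart.{u} n Q)) :
    OpenPartialHomeomorph.refl (Total V) ∈ Psi V :=
  ⟨⟨contMDiffOn_id, contMDiffOn_id⟩, fun _ _ ↦ rfl⟩

theorem trans_mem_Psi {V : Set (OrbChart.{u} n Q)}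
    {f g : OpenPartialHomeomorph (Total V) (Total V)} (hf : f ∈ Psi V) (hg : g ∈ Psi V) :
    f.trans g ∈ Psi V := by
  refine ⟨⟨?_, ?_⟩, fun x hx ↦ ?_⟩
  · rw [f.trans_source, OpenPartialHomeomorph.coe_trans]
    exact hg.1.1.comp' hf.1.1
  · rw [f.trans_target, OpenPartialHomeomorph.coe_trans_symm]
    exact hf.1.2.comp' hg.1.2
  · rw [OpenPartialHomeomorph.trans_source] at hx
    exact (hg.2 _ hx.2).trans (hf.2 _ hx.1)

theorem symm_mem_Psi {V : Set (OrbChart.{u} n Q)}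
    {f : OpenPartialHomeomorph (Total V) (Total V)} (hf : f ∈ Psi V) : f.symm ∈ Psi V := by
  refine ⟨⟨hf.1.2, by simpa using hf.1.1⟩, fun x hx ↦ ?_⟩
  have := hf.2 _ (f.map_target hx)
  rw [f.right_inv hx] at this
  exact this.symm

theorem restrOpen_mem_Psi {V : Set (OrbChart.{u} n Q)}
    {f : OpenPartialHomeomorph (Total V) (Total V)} (hf : f ∈ Psi V) {s : Set (Total V)}
    (hs : IsOpen s) : f.restrOpen s hs ∈ Psi V := by
  refine ⟨⟨hf.1.1.mono ?_, hf.1.2.mono ?_⟩, fun x hx ↦ hf.2 x ?_⟩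
  · rw [f.restrOpen_source]; exact inter_subset_left
  · exact fun y hy ↦ hy.1
  · rw [f.restrOpen_source] at hx; exact hx.1

/-! ### The atlas groupoid `Γ(V)`: objects `Total V`, arrows the germs of elements of `Ψ(V)` -/

/-- The arrows of `Γ(V)`: pairs of a point `x` and the germ at `x` of an element of `Ψ(V)` whose
domain contains `x`. -/
def Arrow (V : Set (OrbChart.{u} n Q)) : Type _ :=
  {γ : Σ x : Total V, Germ (𝓝 x) (Total V) //
    ∃ f ∈ Psi V, γ.1 ∈ f.source ∧ γ.2 = ((f : Total V → Total V) : Germ (𝓝 γ.1) (Total V))}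

namespace Arrow

variable {V : Set (OrbChart.{u} n Q)}

/-- The source map `s`. -/
def src (γ : Arrow V) : Total V := γ.1.1

/-- The underlying germ at the source. -/
def germ (γ : Arrow V) : Germ (𝓝 γ.src) (Total V) := γ.1.2

/-- The target map `t`: `t (germ_x f) = f x`. -/
def tgt (γ : Arrow V) : Total V := γ.germ.value

/-- The arrow `germ_x f`. -/
def mk (f : OpenPartialHomeomorph (Total V) (Total V)) (hf : f ∈ Psi V) (x : Total V)
    (hx : x ∈ f.source) : Arrow V :=
  ⟨⟨x, ((f : Total V → Total V) : Germ (𝓝 x) (Total V))⟩, f, hf, hx, rfl⟩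

/-- A chosen element of `Ψ(V)` representing an arrow. -/
def rep (γ : Arrow V) : OpenPartialHomeomorph (Total V) (Total V) := γ.2.choose

theorem rep_mem (γ : Arrow V) : γ.rep ∈ Psi V := γ.2.choose_spec.1

theorem src_mem_rep (γ : Arrow V) : γ.src ∈ γ.rep.source := γ.2.choose_spec.2.1

theorem germ_eq_rep (γ : Arrow V) :
    γ.germ = ((γ.rep : Total V → Total V) : Germ (𝓝 γ.src) (Total V)) := γ.2.choose_spec.2.2

theorem rep_src (γ : Arrow V) : γ.rep γ.src = γ.tgt := by
  rw [tgt, germ_eq_rep]; rfl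

/-- The unit map `u`: `u x = germ_x id`. -/
def unit (x : Total V) : Arrow V := mk (OpenPartialHomeomorph.refl _) (refl_mem_Psi V) x trivial

/-- The multiplication `m`: `m (germ_{f x} g, germ_x f) = germ_x (g ∘ f)`. -/
def mul (γ δ : Arrow V) (h : γ.src = δ.tgt) : Arrow V :=
  mk (δ.rep.trans γ.rep) (trans_mem_Psi δ.rep_mem γ.rep_mem) δ.src (by
    rw [OpenPartialHomeomorph.trans_source]
    refine ⟨δ.src_mem_rep, ?_⟩
    rw [mem_preimage, rep_src, ← h]
    exact γ.src_mem_rep)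

/-- The inversion `i`: `i (germ_x f) = germ_{f x} f⁻¹`. -/
def inv (γ : Arrow V) : Arrow V :=
  mk γ.rep.symm (symm_mem_Psi γ.rep_mem) γ.tgt (by
    rw [← rep_src]; exact γ.rep.map_source γ.src_mem_rep)

theorem mk_eq_mk {f g : OpenPartialHomeomorph (Total V) (Total V)} {hf : f ∈ Psi V}
    {hg : g ∈ Psi V} {x : Total V} {hx : x ∈ f.source} {hx' : x ∈ g.source} :
    mk f hf x hx = mk g hg x hx' ↔ f =ᶠ[𝓝 x] g := by
  rw [← Germ.coe_eq]
  refine ⟨fun h ↦ eq_of_heq (Sigma.mk.inj (congrArg Subtype.val h)).2, fun h ↦ ?_⟩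
  exact Subtype.ext (Sigma.ext rfl (heq_of_eq h))

theorem mk_rep (γ : Arrow V) : mk γ.rep γ.rep_mem γ.src γ.src_mem_rep = γ := by
  apply Subtype.ext
  refine Sigma.ext rfl ?_
  exact heq_of_eq γ.germ_eq_rep.symm

theorem rep_mk {f : OpenPartialHomeomorph (Total V) (Total V)} (hf : f ∈ Psi V) {x : Total V}
    (hx : x ∈ f.source) : (mk f hf x hx).rep =ᶠ[𝓝 x] f :=
  Germ.coe_eq.1 (germ_eq_rep (mk f hf x hx)).symm

/-- The multiplication does not depend on the chosen representatives. -/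
theorem mul_mk {f g : OpenPartialHomeomorph (Total V) (Total V)} (hf : f ∈ Psi V)
    (hg : g ∈ Psi V) {x : Total V} (hx : x ∈ f.source) (hy : f x ∈ g.source) :
    mul (mk g hg (f x) hy) (mk f hf x hx) rfl =
      mk (f.trans g) (trans_mem_Psi hf hg) x (by
        rw [OpenPartialHomeomorph.trans_source]; exact ⟨hx, hy⟩) := by
  refine mk_eq_mk.2 ?_
  have h1 : (mk f hf x hx).rep =ᶠ[𝓝 x] f := rep_mk hf hx
  have h2 : (mk g hg (f x) hy).rep =ᶠ[𝓝 (f x)] g := rep_mk hg hy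
  filter_upwards [h1, (f.continuousAt hx).eventually h2] with z hz1 hz2
  simp [hz1, hz2]

/-- The inversion does not depend on the chosen representative. -/
theorem inv_mk {f : OpenPartialHomeomorph (Total V) (Total V)} (hf : f ∈ Psi V) {x : Total V}
    (hx : x ∈ f.source) :
    inv (mk f hf x hx) = mk f.symm (symm_mem_Psi hf) (f x) (f.map_source hx) := by
  refine mk_eq_mk.2 ?_
  have h1 : (mk f hf x hx).rep =ᶠ[𝓝 x] f := rep_mk hf hx
  have hs : x ∈ (mk f hf x hx).rep.source := src_mem_rep _
  generalize (mk f hf x hx).rep = r at h1 hs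
  have hc : Tendsto f.symm (𝓝 (f x)) (𝓝 x) := by
    have := f.continuousAt_symm (f.map_source hx)
    rwa [ContinuousAt, f.left_inv hx] at this
  filter_upwards [hc.eventually h1, hc.eventually (r.open_source.mem_nhds hs),
    f.open_target.mem_nhds (f.map_source hx)] with y hy1 hy2 hy3
  rw [f.right_inv hy3] at hy1
  rw [← r.left_inv hy2, hy1]

/-! The germ topology and the germ differential structure on the arrows. -/

/-- The set `U_f` of the germs of `f`. -/
def basicOpen (f : OpenPartialHomeomorph (Total V) (Total V)) : Set (Arrow V) :=
  {γ | γ.src ∈ f.source ∧ γ.germ = ((f : Total V → Total V) : Germ (𝓝 γ.src) (Total V))}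

instance topologicalSpace : TopologicalSpace (Arrow V) :=
  TopologicalSpace.generateFrom {s | ∃ f ∈ Psi V, s = basicOpen f}

theorem isOpen_basicOpen {f : OpenPartialHomeomorph (Total V) (Total V)} (hf : f ∈ Psi V) :
    IsOpen (basicOpen f) :=
  TopologicalSpace.isOpen_generateFrom_of_mem ⟨f, hf, rfl⟩

theorem continuous_src : Continuous (src : Arrow V → Total V) := by
  refine continuous_def.2 fun s hs ↦ isOpen_iff_mem_nhds.2 fun γ hγ ↦ ?_
  refine mem_of_superset ((isOpen_basicOpen (restrOpen_mem_Psi γ.rep_mem hs)).mem_nhds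
    ⟨?_, γ.germ_eq_rep⟩) fun δ hδ ↦ ?_
  · rw [γ.rep.restrOpen_source]; exact ⟨γ.src_mem_rep, hγ⟩
  · have := hδ.1
    rw [γ.rep.restrOpen_source] at this
    exact this.2

open Classical in
/-- For `f ∈ Ψ(V)`, the bijection `U_f → dom f`, `germ_x f ↦ x`. -/
def germChart (f : OpenPartialHomeomorph (Total V) (Total V)) (hf : f ∈ Psi V) :
    OpenPartialHomeomorph (Arrow V) (Total V) where
  toFun := src
  invFun x := if hx : x ∈ f.source then mk f hf x hx else unit x
  source := basicOpen f
  target := f.source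
  map_source' γ hγ := hγ.1
  map_target' x hx := by rw [dif_pos hx]; exact ⟨hx, rfl⟩
  left_inv' γ hγ := by
    rw [dif_pos hγ.1]
    exact Subtype.ext (Sigma.ext rfl (heq_of_eq hγ.2.symm))
  right_inv' x hx := by rw [dif_pos hx]; rfl
  open_source := isOpen_basicOpen hf
  open_target := f.open_source
  continuousOn_toFun := continuous_src.continuousOn
  continuousOn_invFun := by
    rw [continuousOn_iff_continuous_domRestrict]
    refine continuous_generateFrom_iff.2 ?_
    rintro _ ⟨g, hg, rfl⟩
    have h : IsOpen (f.source ∩ g.source ∩ {x | f =ᶠ[𝓝 x] g}) :=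
      (f.open_source.inter g.open_source).inter (isOpen_setOfPred_eventually_nhds)
    convert h.preimage (continuous_subtype_val (p := (· ∈ f.source))) using 1
    ext ⟨x, hx⟩
    simp only [mem_preimage, domRestrict_apply, dif_pos hx]
    constructor
    · rintro ⟨h1, h2⟩
      exact ⟨⟨hx, h1⟩, Germ.coe_eq.1 h2⟩
    · rintro ⟨⟨_, h1⟩, h2⟩
      exact ⟨h1, Germ.coe_eq.2 h2⟩

/-- The maps `U_f → dom f` are declared to be diffeomorphisms: the charts of the arrow space are
the compositions of these maps with the charts of `∐ V_i`. -/
instance chartedSpace : ChartedSpace (EuclideanSpace ℝ (Fin n)) (Arrow V) where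
  atlas := {e | ∃ (f : OpenPartialHomeomorph (Total V) (Total V)) (hf : f ∈ Psi V),
    ∃ e' ∈ atlas (EuclideanSpace ℝ (Fin n)) (Total V), e = (germChart f hf).trans e'}
  chartAt γ := (germChart γ.rep γ.rep_mem).trans (chartAt (EuclideanSpace ℝ (Fin n)) γ.src)
  mem_chart_source γ := by
    rw [OpenPartialHomeomorph.trans_source]
    exact ⟨⟨γ.src_mem_rep, γ.germ_eq_rep⟩, mem_chart_source (EuclideanSpace ℝ (Fin n)) γ.src⟩
  chart_mem_atlas γ := ⟨_, γ.rep_mem, _, chart_mem_atlas _ _, rfl⟩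

instance isManifold : IsManifold (𝓡 n) ∞ (Arrow V) where
  compatible {e e'} he he' := by
    obtain ⟨f, hf, a, ha, rfl⟩ := he
    obtain ⟨g, hg, b, hb, rfl⟩ := he'
    have hab : a.symm.trans b ∈ contDiffGroupoid ∞ (𝓡 n) :=
      HasGroupoid.compatible ha hb
    set E := ((germChart f hf).trans a).symm.trans ((germChart g hg).trans b) with hE
    have key : ∀ x ∈ E.source, x ∈ (a.symm.trans b).source ∧ E x = (a.symm.trans b) x := by
      intro x hx
      have h1 : x ∈ a.target := by
        simp only [hE, OpenPartialHomeomorph.trans_source, OpenPartialHomeomorph.symm_source,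
          OpenPartialHomeomorph.trans_target] at hx
        exact hx.1.1
      have h2 : a.symm x ∈ f.source := by
        simp only [hE, OpenPartialHomeomorph.trans_source, OpenPartialHomeomorph.symm_source,
          OpenPartialHomeomorph.trans_target] at hx
        exact hx.1.2
      have h3 : (germChart g hg) (((germChart f hf).trans a).symm x) = a.symm x :=
        (germChart f hf).right_inv h2
      have h4 : a.symm x ∈ b.source := by
        rw [← h3]
        simp only [hE, OpenPartialHomeomorph.trans_source] at hx
        exact hx.2.2
      refine ⟨by rw [OpenPartialHomeomorph.trans_source]; exact ⟨h1, h4⟩, ?_⟩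
      exact congrArg b h3
    have hEeq : E ≈ (a.symm.trans b).restr E.source := by
      refine ⟨?_, fun x hx ↦ (key x hx).2⟩
      rw [OpenPartialHomeomorph.restr_source' _ _ E.open_source]
      ext x
      exact ⟨fun hx ↦ ⟨(key x hx).1, hx⟩, fun hx ↦ hx.2⟩
    refine StructureGroupoid.mem_of_eqOnSource _ ?_ hEeq
    exact closedUnderRestriction' hab E.open_source

end Arrow

/-- The orbit space `|Γ(V)|`. -/
def OrbitSpace (V : Set (OrbChart.{u} n Q)) : Type _ :=
  Quot fun x y : Total V ↦ ∃ γ : Arrow V, γ.src = x ∧ γ.tgt = y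

/-- The marking `α_V : |Γ(V)| → Q`, `[x] ↦ π x`. -/
def marking (V : Set (OrbChart.{u} n Q)) : OrbitSpace V → Q :=
  Quot.lift Total.proj (by
    rintro _ _ ⟨γ, rfl, rfl⟩
    rw [← γ.rep_src]
    exact (γ.rep_mem.2 _ γ.src_mem_rep).symm)

end AtlasGroupoid

/-! ### Homomorphisms of atlas groupoids and charted orbifold maps -/

section Maps

variable {n n' : ℕ} {Q : Type v} [TopologicalSpace Q] {Q' : Type*} [TopologicalSpace Q']

/-- A homomorphism of Lie groupoids `Γ(V) → Γ(V')`: a pair of smooth maps which commutes with all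
structure maps. -/
@[ext]
structure GpdHom (V : Set (OrbChart.{u} n Q)) (V' : Set (OrbChart n' Q')) where
  obj : Total V → Total V'
  arr : Arrow V → Arrow V'
  obj_smooth : ContMDiff (𝓡 n) (𝓡 n') ∞ obj
  arr_smooth : ContMDiff (𝓡 n) (𝓡 n') ∞ arr
  map_src : ∀ γ, (arr γ).src = obj γ.src
  map_tgt : ∀ γ, (arr γ).tgt = obj γ.tgt
  map_unit : ∀ x, arr (Arrow.unit x) = Arrow.unit (obj x)
  map_mul : ∀ (γ δ : Arrow V) (h : γ.src = δ.tgt),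
    arr (γ.mul δ h) = (arr γ).mul (arr δ) (by rw [map_src, map_tgt, h])
  map_inv : ∀ γ, arr γ.inv = (arr γ).inv

/-- The map `|φ| : |Γ(V)| → |Γ(V')|` induced by a homomorphism. -/
def GpdHom.orbitMap {V : Set (OrbChart.{u} n Q)} {V' : Set (OrbChart n' Q')} (φ : GpdHom V V') :
    OrbitSpace V → OrbitSpace V' :=
  Quot.map φ.obj (by
    rintro _ _ ⟨γ, rfl, rfl⟩
    exact ⟨φ.arr γ, φ.map_src γ, φ.map_tgt γ⟩)

/-- A transition on the disjoint union of all charts of `𝒰'` is an open embedding between orbifold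
charts: its domain, which lies in a single `c ∈ 𝒰'`, is (the image under the embedding `j`
of) an orbifold chart `w ∈ 𝒰'`, and on it the transition is an open embedding `k` of
orbifold charts from `w` to some `d ∈ 𝒰'`. -/
def IsEmbeddingOfCharts (𝒰' : OrbStructure n' Q')
    (g : OpenPartialHomeomorph (Total 𝒰'.charts) (Total 𝒰'.charts)) : Prop :=
  ∃ (w c d : 𝒰'.charts) (j : w.1.carrier → c.1.carrier) (k : w.1.carrier → d.1.carrier),
    IsChartEmbedding w.1 c.1 j ∧ IsChartEmbedding w.1 d.1 k ∧
      g.source = range (fun z ↦ (⟨c, j z⟩ : Total 𝒰'.charts)) ∧ ∀ z, g ⟨c, j z⟩ = ⟨d, k z⟩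

/-- A representative `(f, {f̃_i}, P, ν)` of an orbifold map into `(Q', 𝒰')` with domain atlas `V`
and range family contained in the atlas `V' ⊆ 𝒰'`. -/
structure OrbMapRep (V : Set (OrbChart.{u} n Q)) (V' : Set (OrbChart n' Q'))
    (𝒰' : OrbStructure n' Q') (hV' : V' ⊆ 𝒰'.charts) where
  /-- the continuous map `f` -/
  toFun : Q → Q'
  continuous_toFun : Continuous toFun
  /-- the range family `V'_i` -/
  rangeChart : V → V'
  /-- the local lifts `f̃_i : V_i → V'_i` -/
  lift : ∀ i : V, i.1.carrier → (rangeChart i).1.carrier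
  lift_smooth : ∀ i, ContMDiff (𝓡 n) (𝓡 n') ∞ (lift i)
  lift_proj : ∀ i x, (rangeChart i).1.proj (lift i x) = toFun (i.1.proj x)
  /-- the quasi-pseudogroup `P` -/
  P : Set (OpenPartialHomeomorph (Total V) (Total V))
  quasi : IsQuasiPseudogroup n P
  changes : ∀ l ∈ P, IsChangeOfCharts V l
  generates : Generates n P (Psi V)
  /-- the map `ν : P → Ψ(𝒰')` -/
  nu : P → OpenPartialHomeomorph (Total 𝒰'.charts) (Total 𝒰'.charts)
  nu_mem : ∀ l, nu l ∈ Psi 𝒰'.charts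
  nu_embedding : ∀ l, IsEmbeddingOfCharts 𝒰' (nu l)
  /-- `ψ ∘ λ = ν(λ) ∘ ψ` on `dom λ`, where `ψ = ∐ f̃_i` -/
  invariant : ∀ (l : P), ∀ x ∈ l.1.source,
    Total.incl hV' ⟨rangeChart x.1, lift x.1 x.2⟩ ∈ (nu l).source ∧
      nu l (Total.incl hV' ⟨rangeChart x.1, lift x.1 x.2⟩) =
        Total.incl hV' ⟨rangeChart (l.1 x).1, lift (l.1 x).1 (l.1 x).2⟩
  germ_congr : ∀ (l m : P), ∀ x ∈ l.1.source ∩ m.1.source, l.1 =ᶠ[𝓝 x] m.1 →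
    nu l =ᶠ[𝓝 (Total.incl hV' ⟨rangeChart x.1, lift x.1 x.2⟩)] nu m
  germ_mul : ∀ (l m h : P), ∀ x ∈ l.1.source, l.1 x ∈ m.1.source → x ∈ h.1.source →
    (m.1 ∘ l.1) =ᶠ[𝓝 x] h.1 →
      (nu m ∘ nu l) =ᶠ[𝓝 (Total.incl hV' ⟨rangeChart x.1, lift x.1 x.2⟩)] nu h
  germ_unit : ∀ (l : P), ∀ x ∈ l.1.source, l.1 =ᶠ[𝓝 x] id →
    nu l =ᶠ[𝓝 (Total.incl hV' ⟨rangeChart x.1, lift x.1 x.2⟩)] id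

namespace OrbMapRep

variable {V : Set (OrbChart.{u} n Q)} {V' : Set (OrbChart n' Q')}
  {𝒰' : OrbStructure n' Q'} {hV' : V' ⊆ 𝒰'.charts}

/-- The map `ψ = ∐ f̃_i`. -/
def psi (r : OrbMapRep V V' 𝒰' hV') (x : Total V) : Total V' :=
  ⟨r.rangeChart x.1, r.lift x.1 x.2⟩

/-- Equivalence of representatives: same `f`, same local lifts (with the same range charts), and
`germ_{ψ(x)} ν₁(λ₁) = germ_{ψ(x)} ν₂(λ₂)` whenever `germ_x λ₁ = germ_x λ₂`. -/
def Equivalent (r₁ r₂ : OrbMapRep V V' 𝒰' hV') : Prop :=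
  r₁.toFun = r₂.toFun ∧ r₁.psi = r₂.psi ∧
    ∀ (l₁ : r₁.P) (l₂ : r₂.P), ∀ x ∈ l₁.1.source ∩ l₂.1.source, l₁.1 =ᶠ[𝓝 x] l₂.1 →
      r₁.nu l₁ =ᶠ[𝓝 (Total.incl hV' (r₁.psi x))] r₂.nu l₂

theorem equivalent_equivalence :
    Equivalence (Equivalent : OrbMapRep V V' 𝒰' hV' → OrbMapRep V V' 𝒰' hV' → Prop) where
  refl r := ⟨rfl, rfl, fun l₁ l₂ x hx h ↦ r.germ_congr l₁ l₂ x hx h⟩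
  symm {r₁ r₂} h := ⟨h.1.symm, h.2.1.symm, fun l₂ l₁ x hx hl ↦ by
    rw [← h.2.1]
    exact (h.2.2 l₁ l₂ x hx.symm hl.symm).symm⟩
  trans {r₁ r₂ r₃} h h' := ⟨h.1.trans h'.1, h.2.1.trans h'.2.1, fun l₁ l₃ x hx hl ↦ by
    obtain ⟨l₂, hl₂, hx₂, s, hs, hxs, _, he⟩ :=
      r₂.generates.2.1.2 l₁.1 (r₁.changes l₁.1 l₁.2).1 x hx.1
    have h12 : l₁.1 =ᶠ[𝓝 x] l₂ := eventuallyEq_of_mem (hs.mem_nhds hxs) he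
    have e1 := h.2.2 l₁ ⟨l₂, hl₂⟩ x ⟨hx.1, hx₂⟩ h12
    have e2 := h'.2.2 ⟨l₂, hl₂⟩ l₃ x ⟨hx₂, hx.2⟩ (h12.symm.trans hl)
    rw [← h.2.1] at e2
    exact e1.trans e2⟩

variable (V V' 𝒰' hV') in
/-- Equivalence of representatives as a setoid. -/
def setoid : Setoid (OrbMapRep V V' 𝒰' hV') := ⟨Equivalent, equivalent_equivalence⟩

/-- `γ = germ_y g`, for an arrow `γ` of `Γ(V')` and a transition `g` in `Ψ(𝒰')`, where `∐ V'`
is regarded as an open subset of the disjoint union of all charts in `𝒰'`. -/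
def IsGermOf (hV' : V' ⊆ 𝒰'.charts) (γ : Arrow V') (y : Total V')
    (g : OpenPartialHomeomorph (Total 𝒰'.charts) (Total 𝒰'.charts)) : Prop :=
  γ.src = y ∧ Total.incl hV' γ.src ∈ g.source ∧
    γ.germ.map (Total.incl hV') =
      ((g ∘ Total.incl hV' : Total V' → Total 𝒰'.charts) : Germ (𝓝 γ.src) (Total 𝒰'.charts))

/-- The construction of a homomorphism from a representative: `φ₀ = ∐ f̃_i` and
`φ₁ (germ_x λ) = germ_{φ₀ x} ν(λ)` for all `λ ∈ P`, `x ∈ dom λ`. -/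
def Induces (r : OrbMapRep V V' 𝒰' hV') (φ : GpdHom V V') : Prop :=
  φ.obj = r.psi ∧ ∀ (l : r.P) (x : Total V) (hx : x ∈ l.1.source),
    IsGermOf hV' (φ.arr (Arrow.mk l.1 (r.changes l.1 l.2).1 x hx)) (φ.obj x) (r.nu l)

/-- The construction of a representative from a homomorphism: `f = α_{V'} ∘ |φ| ∘ α_V⁻¹`,
`f̃_i = φ₀` on `V_i`, and `(P, ν)` is chosen so that `φ₁ (germ_x λ) = germ_{φ₀ x} ν(λ)` for all
`λ ∈ P`, `x ∈ dom λ`. -/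
def IsInducedBy (r : OrbMapRep V V' 𝒰' hV') (φ : GpdHom V V') : Prop :=
  (∀ z : OrbitSpace V, r.toFun (marking V z) = marking V' (φ.orbitMap z)) ∧
  (∀ (i : V) (x : i.1.carrier),
    (⟨r.rangeChart i, r.lift i x⟩ : Total V') = φ.obj ⟨i, x⟩) ∧
  ∀ (l : r.P) (x : Total V) (hx : x ∈ l.1.source),
    IsGermOf hV' (φ.arr (Arrow.mk l.1 (r.changes l.1 l.2).1 x hx)) (φ.obj x) (r.nu l)

end OrbMapRep

/-- The set `Orbmap(V, V')` of orbifold maps with domain atlas `V` and range atlas `V'`. -/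
def Orbmap (V : Set (OrbChart.{u} n Q)) (V' : Set (OrbChart n' Q'))
    (𝒰' : OrbStructure n' Q') (hV' : V' ⊆ 𝒰'.charts) : Type _ :=
  Quotient (OrbMapRep.setoid V V' 𝒰' hV')

/-- The equivalence class of a representative. -/
def OrbMapRep.toOrbmap {V : Set (OrbChart.{u} n Q)} {V' : Set (OrbChart n' Q')}
    {𝒰' : OrbStructure n' Q'} {hV' : V' ⊆ 𝒰'.charts} (r : OrbMapRep V V' 𝒰' hV') :
    Orbmap V V' 𝒰' hV' :=
  Quotient.mk (OrbMapRep.setoid V V' 𝒰' hV') r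

end Maps

end OrbGpd

end

noncomputable section

namespace OrbGpd

universe u v w t

/-! ### Diffeomorphisms between open subsets -/

section Diffeo

variable {n : ℕ} {M N K : Type*} [TopologicalSpace M] [TopologicalSpace N] [TopologicalSpace K]
  [ChartedSpace (EuclideanSpace ℝ (Fin n)) M] [ChartedSpace (EuclideanSpace ℝ (Fin n)) N]
  [ChartedSpace (EuclideanSpace ℝ (Fin n)) K]

/-! Both sides encode the same data: a smooth object map `ψ` together with, for each germ of `Ψ(V)`,
a germ of `Ψ(V')` over `ψ`. The relation `IsGermOf` compares an arrow of `Γ(V')` with the germ of a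
transition on all charts of `𝒰'`. Since `∐ V'` is open in that disjoint union, at points of `∐ V'`
the arrow and the germ determine each other (`IsGermOf.unique`, `IsGermOf.eventuallyEq`).

From a representative to a homomorphism: `P` generates `Ψ(V)`, so each arrow is `germ_x λ` with `λ ∈
P`. The germ of `ν(λ)` at `ψ(x)` starts and ends in `∐ V'`, so it is an arrow of `Γ(V')`,
independent of `λ` by (b). Conditions (c) and (d) give compatibility with products and units, and
together with inverses. Near a given arrow the arrow map is `src`, then `ψ`, then a section `y ↦
germ_y f` for one fixed `f`, hence smooth.

From a homomorphism `φ` to a representative: the work lies in finding `P` and `ν`. Each arrow of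
`Γ(V')` is a germ of a restriction `f'` of an open embedding `g` of charts
(`Arrow.exists_isEmbeddingOfCharts`), because a point of a chart has small connected neighbourhoods
stable under the relevant group elements (`OrbChart.exists_stable_nhd`), and these are charts of
`𝒰'` by maximality (`OrbStructure.sub_mem`). By continuity of `φ₁`, all germs of `f` near `x` go to
germs of the same `f'`, so a small connected restriction `λ` of `f` admits `ν(λ) = g`
(`exists_mem_liftable`). All such `λ` form `P`; functoriality of `φ` gives (b), (c) and (d).

Finally, two representatives are equivalent exactly when they induce the same homomorphism
(`Induces.of_equivalent`, `Induces.equivalent`), so the two constructions are mutually inverse. -/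

theorem IsDiffeo.symm {f : OpenPartialHomeomorph M N} (hf : IsDiffeo n f) : IsDiffeo n f.symm :=
  ⟨hf.2, by simpa using hf.1⟩

theorem IsDiffeo.trans {f : OpenPartialHomeomorph M N} {g : OpenPartialHomeomorph N K}
    (hf : IsDiffeo n f) (hg : IsDiffeo n g) : IsDiffeo n (f.trans g) := by
  refine ⟨?_, ?_⟩
  · rw [f.trans_source, OpenPartialHomeomorph.coe_trans]
    exact hg.1.comp' hf.1
  · rw [f.trans_target, OpenPartialHomeomorph.coe_trans_symm]
    exact hf.2.comp' hg.2

theorem IsDiffeo.restrOpen {f : OpenPartialHomeomorph M N} (hf : IsDiffeo n f) {s : Set M}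
    (hs : IsOpen s) : IsDiffeo n (f.restrOpen s hs) := by
  refine ⟨hf.1.mono ?_, hf.2.mono fun y hy ↦ hy.1⟩
  rw [f.restrOpen_source]; exact inter_subset_left

theorem IsDiffeo.congr {f g : OpenPartialHomeomorph M N} (hf : IsDiffeo n f) (h : f ≈ g) :
    IsDiffeo n g := by
  refine ⟨?_, ?_⟩
  · rw [← h.source_eq]
    exact hf.1.congr fun x hx ↦ (h.eqOn hx).symm
  · have h' := OpenPartialHomeomorph.EqOnSource.symm' h
    have e := h'.source_eq
    simp only [OpenPartialHomeomorph.symm_source] at e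
    rw [← e]
    exact hf.2.congr fun x hx ↦ (h'.eqOn hx).symm

theorem IsDiffeo.isLocalDiffeomorphAt {f : OpenPartialHomeomorph M N} (hf : IsDiffeo n f)
    {x : M} (hx : x ∈ f.source) : IsLocalDiffeomorphAt (𝓡 n) (𝓡 n) ∞ f x :=
  ⟨{ f.toPartialEquiv with
      open_source := f.open_source
      open_target := f.open_target
      contMDiffOn_toFun := hf.1
      contMDiffOn_invFun := hf.2 }, hx, fun _ _ ↦ rfl⟩

/-- A partial homeomorphism that intertwines the preferred charts is a diffeomorphism. -/
theorem isDiffeo_of_chartAt_eventuallyEq [IsManifold (𝓡 n) ∞ M] [IsManifold (𝓡 n) ∞ N]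
    (f : OpenPartialHomeomorph M N)
    (h : ∀ x ∈ f.source, chartAt (EuclideanSpace ℝ (Fin n)) (f x) ∘ f =ᶠ[𝓝 x]
      chartAt (EuclideanSpace ℝ (Fin n)) x) : IsDiffeo n f := by
  refine ⟨fun x hx ↦ ContMDiffAt.contMDiffWithinAt ?_,
    fun y hy ↦ ContMDiffAt.contMDiffWithinAt ?_⟩
  · refine contMDiffAt_iff_target.2 ⟨f.continuousAt hx, ?_⟩
    refine (contMDiffAt_extChartAt (n := ∞) (I := 𝓡 n) (x := x)).congr_of_eventuallyEq ?_
    filter_upwards [h x hx] with z hz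
    simpa using hz
  · refine contMDiffAt_iff_target.2 ⟨f.symm.continuousAt hy, ?_⟩
    refine (contMDiffAt_extChartAt (n := ∞) (I := 𝓡 n) (x := y)).congr_of_eventuallyEq ?_
    have h1 := h _ (f.map_target hy)
    rw [f.right_inv hy] at h1
    filter_upwards [(f.symm.continuousAt hy).eventually h1, f.open_target.mem_nhds hy] with z hz hzt
    simp only [Function.comp_apply, f.right_inv hzt] at hz
    simpa using hz.symm

end Diffeo

/-! ### Inclusions of charts, subfamilies, germs and open subsets as diffeomorphisms. -/

section Inclusions

variable {n : ℕ} {Q : Type v} [TopologicalSpace Q]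

/-- The inclusion of a chart into the disjoint union, as a partial homeomorphism. -/
def Total.mkHomeo {V : Set (OrbChart.{u} n Q)} (c : V) :
    OpenPartialHomeomorph c.1.carrier (Total V) :=
  (IsOpenEmbedding.sigmaMk (σ := fun c : V ↦ c.1.carrier) (i := c)).toOpenPartialHomeomorph

variable {V W : Set (OrbChart.{u} n Q)}

@[simp]
theorem Total.mkHomeo_apply (c : V) (x : c.1.carrier) : Total.mkHomeo c x = ⟨c, x⟩ := rfl

@[simp]
theorem Total.mkHomeo_source (c : V) : (Total.mkHomeo c).source = univ := rfl

theorem Total.mkHomeo_target (c : V) : (Total.mkHomeo c).target = range (Sigma.mk c) :=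
  IsOpenEmbedding.toOpenPartialHomeomorph_target _ _

theorem Total.mem_mkHomeo_target {c : V} {x : Total V} :
    x ∈ (Total.mkHomeo c).target ↔ x.1 = c := by
  rw [Total.mkHomeo_target]
  constructor
  · rintro ⟨z, rfl⟩; rfl
  · rintro rfl; exact ⟨x.2, rfl⟩

@[simp]
theorem Total.mkHomeo_symm_mk (c : V) (x : c.1.carrier) : (Total.mkHomeo c).symm ⟨c, x⟩ = x :=
  (Total.mkHomeo c).left_inv (mem_univ x)

theorem Total.chartAt_apply (c : V) (x z : c.1.carrier) :
    chartAt (EuclideanSpace ℝ (Fin n)) (⟨c, x⟩ : Total V) ⟨c, z⟩ =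
      chartAt (EuclideanSpace ℝ (Fin n)) x z :=
  OpenPartialHomeomorph.lift_openEmbedding_apply _ _

theorem Total.isDiffeo_mkHomeo (c : V) : IsDiffeo n (Total.mkHomeo c) :=
  isDiffeo_of_chartAt_eventuallyEq _ fun x _ ↦ Eventually.of_forall fun z ↦
    Total.chartAt_apply c x z

theorem Total.isOpen_fst_eq (c : V) : IsOpen {x : Total V | x.1 = c} := by
  convert (Total.mkHomeo c).open_target using 1
  ext x
  exact Total.mem_mkHomeo_target.symm

theorem Total.incl_injective (h : V ⊆ W) : Function.Injective (Total.incl h) := by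
  rintro ⟨⟨c, hc⟩, x⟩ ⟨⟨d, hd⟩, y⟩ hxy
  simp only [Total.incl, Sigma.mk.injEq, Subtype.mk.injEq] at hxy
  obtain ⟨rfl, hxy⟩ := hxy
  rw [eq_of_heq hxy]

theorem Total.isOpenEmbedding_incl (h : V ⊆ W) : IsOpenEmbedding (Total.incl h) := by
  refine .of_continuous_injective_isOpenMap ?_ (Total.incl_injective h) ?_
  · exact continuous_sigma fun c ↦
      continuous_sigmaMk (σ := fun c : W ↦ c.1.carrier) (i := ⟨c.1, h c.2⟩)
  · refine isOpenMap_sigma.2 fun c ↦ ?_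
    exact isOpenMap_sigmaMk (σ := fun c : W ↦ c.1.carrier) (i := ⟨c.1, h c.2⟩)

theorem Total.map_incl_nhds (h : V ⊆ W) (x : Total V) :
    map (Total.incl h) (𝓝 x) = 𝓝 (Total.incl h x) :=
  (Total.isOpenEmbedding_incl h).map_nhds_eq x

/-- The inclusion of disjoint unions, as a partial homeomorphism. -/
def Total.inclHomeo [Nonempty (Total V)] (h : V ⊆ W) :
    OpenPartialHomeomorph (Total V) (Total W) :=
  (Total.isOpenEmbedding_incl h).toOpenPartialHomeomorph

theorem Total.isDiffeo_inclHomeo [Nonempty (Total V)] (h : V ⊆ W) :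
    IsDiffeo n (Total.inclHomeo h) := by
  refine isDiffeo_of_chartAt_eventuallyEq _ ?_
  rintro ⟨c, x⟩ _
  filter_upwards [(Total.isOpen_fst_eq c).mem_nhds rfl]
  rintro ⟨d, z⟩ rfl
  exact (Total.chartAt_apply (V := W) ⟨d.1, h d.2⟩ x z).trans (Total.chartAt_apply d x z).symm

/-- The chart at an arrow is `src` followed by the chart at its source, whichever representative is
chosen, so the intertwining condition is definitional. -/
theorem Arrow.isDiffeo_germChart (f : OpenPartialHomeomorph (Total V) (Total V))
    (hf : f ∈ Psi V) : IsDiffeo n (Arrow.germChart f hf) :=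
  isDiffeo_of_chartAt_eventuallyEq _ fun _ _ ↦ Eventually.of_forall fun _ ↦ rfl

theorem Arrow.contMDiff_src : ContMDiff (𝓡 n) (𝓡 n) ∞ (Arrow.src : Arrow V → Total V) :=
  fun γ ↦ (Arrow.isDiffeo_germChart γ.rep γ.rep_mem).1.contMDiffAt
    ((Arrow.isOpen_basicOpen γ.rep_mem).mem_nhds ⟨γ.src_mem_rep, γ.germ_eq_rep⟩)

theorem isDiffeo_subtypeCoe {M : Type*} [TopologicalSpace M]
    [ChartedSpace (EuclideanSpace ℝ (Fin n)) M] [IsManifold (𝓡 n) ∞ M]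
    (s : TopologicalSpace.Opens M) (hs : Nonempty s) :
    IsDiffeo n (s.openPartialHomeomorphSubtypeCoe hs) :=
  isDiffeo_of_chartAt_eventuallyEq _ fun x _ ↦ Eventually.of_forall fun z ↦ by
    simp [TopologicalSpace.Opens.chartAt_eq]

end Inclusions

/-! ### Subcharts of an orbifold chart -/

/-- A continuous open map whose fibres are the orbits descends to a continuous open bijection onto
its range. This supplies the field `homeo` of subcharts. -/
theorem exists_homeomorph_orbitQuotient {X Q : Type*} [TopologicalSpace X] [TopologicalSpace Q]
    (G : Subgroup (Equiv.Perm X)) {p : X → Q} (hc : Continuous p) (ho : IsOpenMap p)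
    (h : ∀ x y, p x = p y ↔ ∃ g ∈ G, g x = y) :
    ∃ e : Quotient (MulAction.orbitRel G X) ≃ₜ range p, ∀ x, (e (Quotient.mk _ x) : Q) = p x := by
  have horb : ∀ x y, (MulAction.orbitRel G X) x y ↔ p x = p y := by
    intro x y
    rw [MulAction.orbitRel_apply, MulAction.mem_orbit_iff, eq_comm (a := p x), h]
    constructor
    · rintro ⟨g, hg⟩
      exact ⟨g.1, g.2, hg⟩
    · rintro ⟨g, hg, hgx⟩
      exact ⟨⟨g, hg⟩, hgx⟩
  let F : Quotient (MulAction.orbitRel G X) → range p :=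
    Quotient.lift (fun x ↦ ⟨p x, mem_range_self x⟩) fun x y hxy ↦ Subtype.ext ((horb x y).1 hxy)
  have hF : Function.Bijective F := by
    constructor
    · rintro ⟨x⟩ ⟨y⟩ hxy
      exact Quotient.sound ((horb x y).2 (congrArg Subtype.val hxy))
    · rintro ⟨_, x, rfl⟩
      exact ⟨Quotient.mk _ x, rfl⟩
  have hFc : Continuous F := continuous_quot_lift _ (hc.subtype_mk _)
  have hFo : IsOpenMap F := by
    intro s hs
    have : F '' s = Subtype.val ⁻¹' (p '' (Quotient.mk (MulAction.orbitRel G X) ⁻¹' s)) := by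
      ext ⟨q, hq⟩
      constructor
      · rintro ⟨⟨x⟩, hx, hxq⟩
        exact ⟨x, hx, congrArg Subtype.val hxq⟩
      · rintro ⟨x, hx, hxq⟩
        exact ⟨Quotient.mk _ x, hx, Subtype.ext hxq⟩
    rw [this]
    exact (ho _ (hs.preimage continuous_quot_mk)).preimage continuous_subtype_val
  exact ⟨(Equiv.ofBijective F hF).toHomeomorphOfContinuousOpen hFc hFo, fun _ ↦ rfl⟩

namespace OrbChart

variable {n : ℕ} {Q : Type v} [TopologicalSpace Q] (c : OrbChart.{u} n Q)

theorem continuous_of_mem_group {g : Equiv.Perm c.carrier} (hg : g ∈ c.group) : Continuous g :=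
  (c.group_smooth g hg).continuous

theorem continuous_proj : Continuous c.proj := by
  obtain ⟨h, hh⟩ := c.homeo
  have : c.proj = fun x ↦ (h (Quotient.mk _ x) : Q) := funext fun x ↦ (hh x).symm
  rw [this]
  exact continuous_subtype_val.comp (h.continuous.comp continuous_quot_mk)

theorem isOpenMap_proj : IsOpenMap c.proj := by
  obtain ⟨h, hh⟩ := c.homeo
  have : c.proj = fun x ↦ (h (Quotient.mk _ x) : Q) := funext fun x ↦ (hh x).symm
  rw [this]
  have : ContinuousConstSMul c.group c.carrier := ⟨fun g ↦ c.continuous_of_mem_group g.2⟩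
  exact c.isOpen_range.isOpenMap_subtype_val.comp (h.isOpenMap.comp isOpenMap_quotient_mk'_mul)

theorem proj_eq_iff {x y : c.carrier} : c.proj x = c.proj y ↔ ∃ g ∈ c.group, g x = y := by
  obtain ⟨h, hh⟩ := c.homeo
  rw [← hh, ← hh, Subtype.coe_inj, h.injective.eq_iff, eq_comm, Quotient.eq,
    MulAction.orbitRel_apply, MulAction.mem_orbit_iff]
  constructor
  · rintro ⟨g, hg⟩
    exact ⟨g.1, g.2, hg⟩
  · rintro ⟨g, hg, hgx⟩
    exact ⟨⟨g, hg⟩, hgx⟩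

instance locallyConnectedSpace_carrier : LocallyConnectedSpace c.carrier :=
  ChartedSpace.locallyConnectedSpace (EuclideanSpace ℝ (Fin n)) c.carrier

/-- The orbifold chart given by a connected open subset `s` of a chart such that each group element
mapping some point of `s` into `s` maps `s` into itself. -/
def sub (s : TopologicalSpace.Opens c.carrier) (hconn : IsConnected (s : Set c.carrier))
    (hs : ∀ g ∈ c.group, (∃ x ∈ s, g x ∈ s) → ∀ x ∈ s, g x ∈ s) : OrbChart.{u} n Q :=
  haveI : ConnectedSpace s := isConnected_iff_connectedSpace.1 hconn
  -- The group consists of permutations of `s` that extend to elements of `c.group`, so it acts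
  -- faithfully by construction. Finiteness follows because a permutation is determined by any
  -- chosen extension.
  let G : Subgroup (Equiv.Perm s) :=
    { carrier := {σ | ∃ g ∈ c.group, ∀ z : s, (σ z : c.carrier) = g z}
      one_mem' := ⟨1, c.group.one_mem, fun _ ↦ rfl⟩
      mul_mem' := by
        rintro σ τ ⟨g, hg, hσ⟩ ⟨h, hh, hτ⟩
        exact ⟨g * h, c.group.mul_mem hg hh, fun z ↦ by simp [hσ, hτ]⟩
      inv_mem' := by
        rintro σ ⟨g, hg, hσ⟩
        refine ⟨g⁻¹, c.group.inv_mem hg, fun z ↦ ?_⟩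
        rw [Equiv.Perm.eq_inv_iff_eq, ← hσ]
        exact congrArg Subtype.val (σ.apply_symm_apply z) }
  { carrier := s
    group := G
    group_finite := by
      have := c.group_finite
      choose f hf hfz using fun σ : G ↦ σ.2
      refine Finite.of_injective (fun σ : G ↦ (⟨f σ, hf σ⟩ : c.group)) fun σ τ hστ ↦ ?_
      have : f σ = f τ := congrArg Subtype.val hστ
      refine Subtype.ext (Equiv.ext fun z ↦ Subtype.ext ?_)
      rw [hfz, hfz, this]
    group_smooth := by
      rintro σ ⟨g, hg, hσ⟩
      have h1 : ContMDiff (𝓡 n) (𝓡 n) ∞ (fun z : s ↦ g z) :=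
        (c.group_smooth g hg).comp contMDiff_subtype_val
      intro z
      refine (ContMDiffAt.congr_of_eventuallyEq ((isDiffeo_subtypeCoe s ⟨z⟩).2.contMDiffAt
        (x := g z) ?_ |>.comp z (h1 z)) ?_)
      · rw [← hσ]
        exact (s.openPartialHomeomorphSubtypeCoe ⟨z⟩).open_target.mem_nhds
          ((s.openPartialHomeomorphSubtypeCoe ⟨z⟩).map_source trivial)
      · refine Eventually.of_forall fun y ↦ ?_
        simp only [Function.comp_apply, ← hσ]
        exact ((s.openPartialHomeomorphSubtypeCoe ⟨z⟩).left_inv (mem_univ (σ y))).symm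
    proj := fun z ↦ c.proj z
    isOpen_range := by
      rw [← image_univ]
      exact (c.isOpenMap_proj.comp s.isOpen.isOpenMap_subtype_val) _ isOpen_univ
    homeo := by
      refine exists_homeomorph_orbitQuotient G (c.continuous_proj.comp continuous_subtype_val)
        (c.isOpenMap_proj.comp s.isOpen.isOpenMap_subtype_val) fun x y ↦ ?_
      rw [c.proj_eq_iff]
      constructor
      · rintro ⟨g, hg, hgx⟩
        -- Stability is needed for both `g` and `g⁻¹`, so that `g` restricts to a permutation of
        -- `s`.
        have h1 := hs g hg ⟨x, x.2, by rw [hgx]; exact y.2⟩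
        have h2 := hs g⁻¹ (c.group.inv_mem hg) ⟨y, y.2, by
          rw [← hgx]
          exact (congrArg (· ∈ s) (g.symm_apply_apply x)).mpr x.2⟩
        refine ⟨⟨fun z ↦ ⟨g z, h1 z z.2⟩, fun z ↦ ⟨g⁻¹ z, h2 z z.2⟩, fun z ↦ ?_, fun z ↦ ?_⟩,
          ⟨g, hg, fun _ ↦ rfl⟩, Subtype.ext hgx⟩
        · exact Subtype.ext (g.symm_apply_apply z)
        · exact Subtype.ext (g.apply_symm_apply z)
      · rintro ⟨σ, ⟨g, hg, hσ⟩, rfl⟩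
        exact ⟨g, hg, (hσ x).symm⟩ }

/-- Since the group is finite and the chart Hausdorff, near `y` only elements fixing `y` can return
a point to the neighbourhood. The connected component of `y` in a neighbourhood invariant under the
stabilizer is again invariant, because its images under the stabilizer are connected and contain
`y`. -/
theorem exists_stable_nhd (y : c.carrier) {O : Set c.carrier} (hO : IsOpen O) (hy : y ∈ O) :
    ∃ s : TopologicalSpace.Opens c.carrier, y ∈ s ∧ (s : Set c.carrier) ⊆ O ∧
      IsConnected (s : Set c.carrier) ∧
      ∀ g ∈ c.group, (∃ x ∈ s, g x ∈ s) → ∀ x ∈ s, g x ∈ s := by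
  have hfin : (c.group : Set (Equiv.Perm c.carrier)).Finite := c.group_finite
  have hsep : ∀ g ∈ c.group, ∃ B : Set c.carrier, IsOpen B ∧ y ∈ B ∧
      ((∃ x ∈ B, g x ∈ B) → g y = y) := by
    intro g hg
    by_cases h : g y = y
    · exact ⟨univ, isOpen_univ, trivial, fun _ ↦ h⟩
    · obtain ⟨A, B, hA, hB, hyA, hyB, hAB⟩ := t2_separation h
      -- As `g` moves `y`, this neighbourhood of `y` is carried into `A`, which is disjoint from
      -- `B`.
      refine ⟨B ∩ g ⁻¹' A, hB.inter (hA.preimage (c.continuous_of_mem_group hg)), ⟨hyB, hyA⟩, ?_⟩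
      rintro ⟨x, hx, hgx⟩
      exact (disjoint_left.1 hAB hx.2 hgx.1).elim
  choose! B hBo hyB hB using hsep
  let B₀ : Set c.carrier := O ∩ ⋂ g ∈ c.group, B g
  have hB₀ : IsOpen B₀ := hO.inter (hfin.isOpen_biInter hBo)
  have hyB₀ : y ∈ B₀ := ⟨hy, mem_iInter₂.2 hyB⟩
  -- Intersecting the preimages of `B₀` over the whole stabilizer of `y` makes the set invariant
  -- under it; the term `h = 1` keeps it inside `B₀`.
  let B₁ : Set c.carrier := ⋂ h ∈ {h | h ∈ c.group ∧ h y = y}, h ⁻¹' B₀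
  have hB₁ : IsOpen B₁ := (hfin.subset fun h hh ↦ hh.1).isOpen_biInter fun h hh ↦
    hB₀.preimage (c.continuous_of_mem_group hh.1)
  have hyB₁ : y ∈ B₁ := mem_iInter₂.2 fun h hh ↦ by rw [mem_preimage, hh.2]; exact hyB₀
  have hB₁₀ : B₁ ⊆ B₀ := fun x hx ↦ mem_iInter₂.1 hx 1 ⟨c.group.one_mem, rfl⟩
  refine ⟨⟨connectedComponentIn B₁ y, hB₁.connectedComponentIn⟩, mem_connectedComponentIn hyB₁,
    fun x hx ↦ (hB₁₀ (connectedComponentIn_subset _ _ hx)).1,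
    isConnected_connectedComponentIn_iff.2 hyB₁, ?_⟩
  rintro g hg ⟨x, hx, hgx⟩ z hz
  have hgy : g y = y := hB g hg
    ⟨x, mem_iInter₂.1 (hB₁₀ (connectedComponentIn_subset _ _ hx)).2 g hg,
      mem_iInter₂.1 (hB₁₀ (connectedComponentIn_subset _ _ hgx)).2 g hg⟩
  have hmap : g '' B₁ ⊆ B₁ := by
    rintro _ ⟨w, hw, rfl⟩
    exact mem_iInter₂.2 fun h hh ↦ mem_iInter₂.1 hw (h * g)
      ⟨c.group.mul_mem hh.1 hg, by rw [Equiv.Perm.mul_apply, hgy, hh.2]⟩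
  have := (c.continuous_of_mem_group hg).continuousOn.image_connectedComponentIn_subset hyB₁
    (mem_image_of_mem g hz)
  rw [hgy] at this
  exact connectedComponentIn_mono y hmap this

end OrbChart

/-! ### Subcharts belong to the orbifold structure. -/

section Compatible

variable {n : ℕ} {Q : Type v} [TopologicalSpace Q]

/-- Connectedness of the domain is free: manifolds are locally connected, so the component of `x` in
the domain is open. -/
theorem compatible_of_local {c d : OrbChart.{u} n Q}
    (H : ∀ (x : c.carrier) (y : d.carrier), c.proj x = d.proj y →
      ∃ h : OpenPartialHomeomorph c.carrier d.carrier, IsDiffeo n h ∧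
        x ∈ h.source ∧ h x = y ∧ ∀ z ∈ h.source, d.proj (h z) = c.proj z) : Compatible c d := by
  intro x y hxy
  obtain ⟨h, hh, hx, hy, hp⟩ := H x y hxy
  have ho : IsOpen (connectedComponentIn h.source x) := h.open_source.connectedComponentIn
  have hsub := connectedComponentIn_subset h.source x
  have hsrc : (h.restrOpen _ ho).source = connectedComponentIn h.source x := by
    rw [h.restrOpen_source]; exact inter_eq_right.2 hsub
  refine ⟨h.restrOpen _ ho, hh.restrOpen ho, ?_, ?_, hy, fun z hz ↦ hp z ?_⟩
  · rw [hsrc]; exact isConnected_connectedComponentIn_iff.2 hx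
  · rw [hsrc]; exact mem_connectedComponentIn hx
  · rw [hsrc] at hz; exact hsub hz

/-- By maximality only compatibility with the charts of `𝒰` matters, and precomposing the
compatibility diffeomorphisms of `c` with the inclusion of `s` provides it. -/
theorem OrbStructure.sub_mem (𝒰 : OrbStructure.{u} n Q) {c : OrbChart.{u} n Q} (hc : c ∈ 𝒰.charts)
    (s : TopologicalSpace.Opens c.carrier) (hconn : IsConnected (s : Set c.carrier))
    (hs : ∀ g ∈ c.group, (∃ x ∈ s, g x ∈ s) → ∀ x ∈ s, g x ∈ s) :
    c.sub s hconn hs ∈ 𝒰.charts := by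
  refine 𝒰.maximal _ fun d hd ↦ compatible_of_local fun (x : s) y hxy ↦ ?_
  obtain ⟨h, hh, -, hx, hy, hp⟩ := 𝒰.isAtlas.1 c hc d hd x y hxy
  refine ⟨(s.openPartialHomeomorphSubtypeCoe ⟨x⟩).trans h, (isDiffeo_subtypeCoe s ⟨x⟩).trans hh,
    ?_, hy, fun z hz ↦ ?_⟩
  · rw [OpenPartialHomeomorph.trans_source]
    exact ⟨trivial, hx⟩
  · rw [OpenPartialHomeomorph.trans_source] at hz
    exact hp _ hz.2

end Compatible

/-! ### Arrows as germs of transitions on a larger family of charts -/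

section Restriction

variable {n : ℕ} {Q : Type v} [TopologicalSpace Q] {V W : Set (OrbChart.{u} n Q)}

/-- A transition in `Ψ(W)` restricts to a transition in `Ψ(V)` for a subfamily `V` of `W`. -/
theorem exists_mem_Psi_incl (h : V ⊆ W) {g : OpenPartialHomeomorph (Total W) (Total W)}
    (hg : g ∈ Psi W) : ∃ f ∈ Psi V,
      (∀ x y, Total.incl h x ∈ g.source → g (Total.incl h x) = Total.incl h y → x ∈ f.source) ∧
      ∀ x ∈ f.source, Total.incl h x ∈ g.source ∧ Total.incl h (f x) = g (Total.incl h x) := by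
  by_cases hV : Nonempty (Total V)
  · set e := Total.inclHomeo h with he
    have hes : ∀ x, x ∈ e.source := fun x ↦ trivial
    have key : ∀ x ∈ ((e.trans g).trans e.symm).source, Total.incl h x ∈ g.source ∧
        Total.incl h (((e.trans g).trans e.symm) x) = g (Total.incl h x) := by
      intro x hx
      rw [OpenPartialHomeomorph.trans_source, OpenPartialHomeomorph.trans_source] at hx
      exact ⟨hx.1.2, e.right_inv hx.2⟩
    refine ⟨(e.trans g).trans e.symm, ⟨((Total.isDiffeo_inclHomeo h).trans hg.1).trans
      (Total.isDiffeo_inclHomeo h).symm, fun x hx ↦ ?_⟩, fun x y hx hxy ↦ ?_, key⟩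
    · obtain ⟨h1, h2⟩ := key x hx
      exact (congrArg Total.proj h2).trans (hg.2 _ h1)
    · rw [OpenPartialHomeomorph.trans_source, OpenPartialHomeomorph.trans_source]
      refine ⟨⟨hes x, hx⟩, ?_⟩
      change g (Total.incl h x) ∈ e.target
      rw [hxy]
      exact e.map_source (hes y)
  -- When `∐ V` is empty, any transition works vacuously.
  · exact ⟨.refl _, refl_mem_Psi V, fun x ↦ (hV ⟨x⟩).elim, fun x ↦ (hV ⟨x⟩).elim⟩

end Restriction

namespace Arrow

variable {n : ℕ} {Q : Type v} [TopologicalSpace Q] {V : Set (OrbChart.{u} n Q)}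

theorem mk_mem_basicOpen {f g : OpenPartialHomeomorph (Total V) (Total V)} {hf : f ∈ Psi V}
    {x : Total V} {hx : x ∈ f.source} :
    mk f hf x hx ∈ basicOpen g ↔ x ∈ g.source ∧ f =ᶠ[𝓝 x] g :=
  and_congr_right fun _ ↦ Germ.coe_eq

theorem mem_basicOpen_iff {γ : Arrow V} {g : OpenPartialHomeomorph (Total V) (Total V)} :
    γ ∈ basicOpen g ↔ γ.src ∈ g.source ∧ γ.rep =ᶠ[𝓝 γ.src] g := by
  conv_lhs => rw [← γ.mk_rep]
  exact mk_mem_basicOpen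

theorem tgt_eq_of_mem_basicOpen {γ : Arrow V} {g : OpenPartialHomeomorph (Total V) (Total V)}
    (h : γ ∈ basicOpen g) : γ.tgt = g γ.src := by
  rw [← rep_src]
  exact (mem_basicOpen_iff.1 h).2.eq_of_nhds

theorem eq_mk_of_mem_basicOpen {γ : Arrow V} {g : OpenPartialHomeomorph (Total V) (Total V)}
    (hg : g ∈ Psi V) (h : γ ∈ basicOpen g) : γ = mk g hg γ.src h.1 := by
  conv_lhs => rw [← γ.mk_rep]
  exact mk_eq_mk.2 (mem_basicOpen_iff.1 h).2

theorem germChart_symm_apply {f : OpenPartialHomeomorph (Total V) (Total V)} (hf : f ∈ Psi V)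
    {x : Total V} (hx : x ∈ f.source) : (germChart f hf).symm x = mk f hf x hx :=
  dif_pos hx

end Arrow

/-! ### Calculus of the relation `IsGermOf`. -/

namespace OrbMapRep

variable {n' : ℕ} {Q' : Type t} [TopologicalSpace Q']
  {V' : Set (OrbChart.{w} n' Q')} {𝒰' : OrbStructure.{w} n' Q'} {hV' : V' ⊆ 𝒰'.charts}

theorem isGermOf_mk {f : OpenPartialHomeomorph (Total V') (Total V')} {hf : f ∈ Psi V'}
    {x y : Total V'} {hx : x ∈ f.source}
    {g : OpenPartialHomeomorph (Total 𝒰'.charts) (Total 𝒰'.charts)} :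
    IsGermOf hV' (Arrow.mk f hf x hx) y g ↔ x = y ∧ Total.incl hV' x ∈ g.source ∧
      Total.incl hV' ∘ f =ᶠ[𝓝 x] g ∘ Total.incl hV' :=
  and_congr_right fun _ ↦ and_congr_right fun _ ↦ Germ.coe_eq

theorem isGermOf_iff {γ : Arrow V'} {y : Total V'}
    {g : OpenPartialHomeomorph (Total 𝒰'.charts) (Total 𝒰'.charts)} :
    IsGermOf hV' γ y g ↔ γ.src = y ∧ Total.incl hV' γ.src ∈ g.source ∧
      Total.incl hV' ∘ γ.rep =ᶠ[𝓝 γ.src] g ∘ Total.incl hV' := by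
  conv_lhs => rw [← γ.mk_rep]
  exact isGermOf_mk

theorem IsGermOf.incl_tgt {γ : Arrow V'} {y : Total V'}
    {g : OpenPartialHomeomorph (Total 𝒰'.charts) (Total 𝒰'.charts)} (h : IsGermOf hV' γ y g) :
    Total.incl hV' γ.tgt = g (Total.incl hV' y) := by
  obtain ⟨rfl, -, h⟩ := isGermOf_iff.1 h
  rw [← γ.rep_src]
  exact h.eq_of_nhds

theorem IsGermOf.mem_source {γ : Arrow V'} {y : Total V'}
    {g : OpenPartialHomeomorph (Total 𝒰'.charts) (Total 𝒰'.charts)} (h : IsGermOf hV' γ y g) :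
    Total.incl hV' y ∈ g.source := by
  obtain ⟨rfl, h, -⟩ := h
  exact h

/-- The inclusion of `∐ V'` is injective, so the values of `g` near `y` recover those of the arrow.
-/
theorem IsGermOf.unique {γ δ : Arrow V'} {y : Total V'}
    {g : OpenPartialHomeomorph (Total 𝒰'.charts) (Total 𝒰'.charts)} (h : IsGermOf hV' γ y g)
    (h' : IsGermOf hV' δ y g) : γ = δ := by
  have h1 := h
  rw [← γ.mk_rep] at h1 ⊢
  obtain ⟨rfl, hs, e⟩ := isGermOf_iff.1 h
  obtain ⟨hsrc, hs', e'⟩ := isGermOf_iff.1 h'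
  have hδ : δ ∈ Arrow.basicOpen γ.rep := by
    rw [Arrow.mem_basicOpen_iff]
    rw [hsrc] at e' ⊢
    refine ⟨γ.src_mem_rep, ?_⟩
    filter_upwards [e, e'] with z hz hz'
    exact Total.incl_injective hV' (hz'.trans hz.symm)
  rw [Arrow.eq_mk_of_mem_basicOpen γ.rep_mem hδ]
  simp only [hsrc]

/-- The inclusion is an open embedding, so a germ at a point of `∐ V'` is determined by its
restriction to `∐ V'`. -/
theorem IsGermOf.eventuallyEq {γ : Arrow V'} {y : Total V'}
    {g g' : OpenPartialHomeomorph (Total 𝒰'.charts) (Total 𝒰'.charts)} (h : IsGermOf hV' γ y g)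
    (h' : IsGermOf hV' γ y g') : g =ᶠ[𝓝 (Total.incl hV' y)] g' := by
  obtain ⟨rfl, -, e⟩ := isGermOf_iff.1 h
  obtain ⟨-, -, e'⟩ := isGermOf_iff.1 h'
  rw [← Total.map_incl_nhds]
  exact e.symm.trans e'

theorem IsGermOf.congr {γ : Arrow V'} {y : Total V'}
    {g g' : OpenPartialHomeomorph (Total 𝒰'.charts) (Total 𝒰'.charts)} (h : IsGermOf hV' γ y g)
    (hg : g =ᶠ[𝓝 (Total.incl hV' y)] g') (hy : Total.incl hV' y ∈ g'.source) :
    IsGermOf hV' γ y g' := by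
  obtain ⟨rfl, -, e⟩ := isGermOf_iff.1 h
  rw [← Total.map_incl_nhds] at hg
  exact isGermOf_iff.2 ⟨rfl, hy, e.trans hg⟩

theorem IsGermOf.mul {γ δ : Arrow V'} {x y : Total V'}
    {g f : OpenPartialHomeomorph (Total 𝒰'.charts) (Total 𝒰'.charts)} (hγ : IsGermOf hV' γ y g)
    (hδ : IsGermOf hV' δ x f) (h : γ.src = δ.tgt) : IsGermOf hV' (γ.mul δ h) x (f.trans g) := by
  obtain ⟨hx, hs, e⟩ := isGermOf_iff.1 hδ
  obtain ⟨hy, hs', e'⟩ := isGermOf_iff.1 hγ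
  refine isGermOf_mk.2 ⟨hx, ?_, ?_⟩
  · rw [OpenPartialHomeomorph.trans_source]
    refine ⟨hs, ?_⟩
    rw [mem_preimage, hx, ← hδ.incl_tgt, ← h]
    exact hs'
  · have hc := δ.rep.continuousAt δ.src_mem_rep
    rw [ContinuousAt, δ.rep_src, ← h] at hc
    filter_upwards [e, hc.eventually e'] with z hz hz'
    simp only [Function.comp_apply] at hz hz'
    simp [← hz, hz']

theorem isGermOf_unit (y : Total V') :
    IsGermOf hV' (Arrow.unit y) y (OpenPartialHomeomorph.refl _) :=
  isGermOf_mk.2 ⟨rfl, trivial, .rfl⟩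

/-- Only a left inverse on germs is required of `g'`: this is what (c) and (d) yield for `ν` of an
inverse germ. -/
theorem IsGermOf.inv {γ : Arrow V'} {y : Total V'}
    {g g' : OpenPartialHomeomorph (Total 𝒰'.charts) (Total 𝒰'.charts)} (h : IsGermOf hV' γ y g)
    (hg : g' ∘ g =ᶠ[𝓝 (Total.incl hV' y)] id) (hy : Total.incl hV' γ.tgt ∈ g'.source) :
    IsGermOf hV' γ.inv γ.tgt g' := by
  obtain ⟨rfl, -, e⟩ := isGermOf_iff.1 h
  rw [← Total.map_incl_nhds] at hg
  have ht : γ.tgt ∈ γ.rep.target := by rw [← γ.rep_src]; exact γ.rep.map_source γ.src_mem_rep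
  refine isGermOf_mk.2 ⟨rfl, hy, ?_⟩
  have hc := γ.rep.symm.continuousAt ht
  rw [ContinuousAt, ← γ.rep_src, γ.rep.left_inv γ.src_mem_rep, γ.rep_src] at hc
  filter_upwards [hc.eventually e, hc.eventually (eventually_map.1 hg),
    γ.rep.open_target.mem_nhds ht] with z hz hz' hzt
  simp only [Function.comp_apply, γ.rep.right_inv hzt] at hz hz' ⊢
  rw [hz, hz', id]

end OrbMapRep

/-! ### The homomorphism induced by a representative of an orbifold map -/

namespace OrbMapRep

variable {n n' : ℕ} {Q : Type v} [TopologicalSpace Q] {Q' : Type t} [TopologicalSpace Q']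
  {V : Set (OrbChart.{u} n Q)} {V' : Set (OrbChart.{w} n' Q')} {𝒰' : OrbStructure.{w} n' Q'}
  {hV' : V' ⊆ 𝒰'.charts} (r : OrbMapRep V V' 𝒰' hV')

theorem contMDiff_psi : ContMDiff (𝓡 n) (𝓡 n') ∞ r.psi := by
  rintro ⟨c, x⟩
  have hmem : (Total.mkHomeo c).target ∈ 𝓝 (⟨c, x⟩ : Total V) :=
    (Total.mkHomeo c).open_target.mem_nhds (Total.mem_mkHomeo_target.2 rfl)
  have h1 := (Total.isDiffeo_mkHomeo c).2.contMDiffAt hmem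
  have h2 := (Total.isDiffeo_mkHomeo (r.rangeChart c)).1.contMDiffAt
    (x := r.lift c ((Total.mkHomeo c).symm ⟨c, x⟩)) univ_mem
  refine ((h2.comp _ (r.lift_smooth c _)).comp _ h1).congr_of_eventuallyEq ?_
  filter_upwards [hmem] with z hz
  obtain ⟨d, z⟩ := z
  obtain rfl : d = c := Total.mem_mkHomeo_target.1 hz
  simp [psi]

theorem exists_mem_P (γ : Arrow V) : ∃ l : r.P, γ ∈ Arrow.basicOpen l.1 := by
  obtain ⟨l, hl, hx, s, hs, hxs, _, he⟩ := r.generates.2.1.2 γ.rep γ.rep_mem γ.src γ.src_mem_rep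
  exact ⟨⟨l, hl⟩, Arrow.mem_basicOpen_iff.2 ⟨hx, eventuallyEq_of_mem (hs.mem_nhds hxs) he⟩⟩

/-- Invariance (a) puts both ends of the germ of `ν(l)` in `∐ V'`, so the germ restricts to an arrow
of `Γ(V')`; by (b) the same arrow serves every `l` with germ `γ`. -/
theorem exists_isGermOf_nu (γ : Arrow V) :
    ∃ δ : Arrow V', ∀ l : r.P, γ ∈ Arrow.basicOpen l.1 → IsGermOf hV' δ (r.psi γ.src) (r.nu l) := by
  obtain ⟨l, hl⟩ := r.exists_mem_P γ
  obtain ⟨f, hf, hfs, hfg⟩ := exists_mem_Psi_incl hV' (r.nu_mem l)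
  obtain ⟨h1, h2⟩ := r.invariant l γ.src hl.1
  have hx : r.psi γ.src ∈ f.source := hfs _ _ h1 h2
  refine ⟨Arrow.mk f hf _ hx, fun m hm ↦ ?_⟩
  have : IsGermOf hV' (Arrow.mk f hf _ hx) (r.psi γ.src) (r.nu l) :=
    isGermOf_mk.2 ⟨rfl, h1, eventuallyEq_of_mem (f.open_source.mem_nhds hx)
      fun z hz ↦ (hfg z hz).2⟩
  exact this.congr (r.germ_congr l m _ ⟨hl.1, hm.1⟩
    ((Arrow.mem_basicOpen_iff.1 hl).2.symm.trans (Arrow.mem_basicOpen_iff.1 hm).2))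
    (r.invariant m γ.src hm.1).1

/-- The map on arrows induced by `ν`. -/
def arrMap (γ : Arrow V) : Arrow V' := (r.exists_isGermOf_nu γ).choose

theorem isGermOf_arrMap {γ : Arrow V} {l : r.P} (h : γ ∈ Arrow.basicOpen l.1) :
    IsGermOf hV' (r.arrMap γ) (r.psi γ.src) (r.nu l) :=
  (r.exists_isGermOf_nu γ).choose_spec l h

theorem src_arrMap (γ : Arrow V) : (r.arrMap γ).src = r.psi γ.src := by
  obtain ⟨l, hl⟩ := r.exists_mem_P γ
  exact (r.isGermOf_arrMap hl).1

theorem tgt_arrMap (γ : Arrow V) : (r.arrMap γ).tgt = r.psi γ.tgt := by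
  obtain ⟨l, hl⟩ := r.exists_mem_P γ
  apply Total.incl_injective hV'
  rw [(r.isGermOf_arrMap hl).incl_tgt, Arrow.tgt_eq_of_mem_basicOpen hl]
  exact (r.invariant l _ hl.1).2

/-- One restriction `f` of `ν(l)` serves all arrows in the open set of germs of `l`, so there the
map is `src`, then `ψ`, then the inverse of the germ chart of `f`. -/
theorem contMDiff_arrMap : ContMDiff (𝓡 n) (𝓡 n') ∞ r.arrMap := by
  intro γ
  obtain ⟨l, hl⟩ := r.exists_mem_P γ
  obtain ⟨f, hf, hfs, hfg⟩ := exists_mem_Psi_incl hV' (r.nu_mem l)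
  have hmem : ∀ x ∈ l.1.source, r.psi x ∈ f.source := fun x hx ↦
    hfs _ _ (r.invariant l x hx).1 (r.invariant l x hx).2
  have h1 := (Arrow.isDiffeo_germChart f hf).2.contMDiffAt
    (f.open_source.mem_nhds (hmem _ hl.1))
  refine (h1.comp γ ((r.contMDiff_psi _).comp γ (Arrow.contMDiff_src γ))).congr_of_eventuallyEq ?_
  filter_upwards [(Arrow.isOpen_basicOpen (r.changes l.1 l.2).1).mem_nhds hl] with δ hδ
  have hx := hmem _ hδ.1
  refine (r.isGermOf_arrMap hδ).unique ?_
  rw [Function.comp_apply, Function.comp_apply, Arrow.germChart_symm_apply hf hx]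
  exact isGermOf_mk.2 ⟨rfl, (hfg _ hx).1, eventuallyEq_of_mem (f.open_source.mem_nhds hx)
    fun z hz ↦ (hfg z hz).2⟩

theorem arrMap_unit (x : Total V) : r.arrMap (Arrow.unit x) = Arrow.unit (r.psi x) := by
  obtain ⟨l, hl⟩ := r.exists_mem_P (Arrow.unit x)
  have h := Arrow.mk_mem_basicOpen.1 hl
  exact (r.isGermOf_arrMap hl).unique ((isGermOf_unit _).congr
    (r.germ_unit l x h.1 h.2.symm).symm (r.invariant l x h.1).1)

theorem arrMap_mul (γ δ : Arrow V) (h : γ.src = δ.tgt) :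
    r.arrMap (γ.mul δ h) = (r.arrMap γ).mul (r.arrMap δ)
      (by rw [src_arrMap, tgt_arrMap, h]) := by
  obtain ⟨l, hl⟩ := r.exists_mem_P δ
  obtain ⟨m, hm⟩ := r.exists_mem_P γ
  -- The composite of `m` and `l` need not lie in `P`; (c) is applied to a third member `k` with the
  -- same germ.
  obtain ⟨k, hk⟩ := r.exists_mem_P (γ.mul δ h)
  have hk' := Arrow.mk_mem_basicOpen.1 hk
  have hlx : l.1 δ.src = γ.src := by rw [h, Arrow.tgt_eq_of_mem_basicOpen hl]
  refine (r.isGermOf_arrMap hk).unique (((r.isGermOf_arrMap hm).mul (r.isGermOf_arrMap hl)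
    (by rw [src_arrMap, tgt_arrMap, h])).congr ?_ (r.isGermOf_arrMap hk).mem_source)
  rw [OpenPartialHomeomorph.coe_trans]
  refine r.germ_mul l m k δ.src hl.1 (by rw [hlx]; exact hm.1) hk'.1
    (EventuallyEq.trans ?_ hk'.2)
  have hc := l.1.continuousAt hl.1
  rw [ContinuousAt, hlx] at hc
  filter_upwards [(Arrow.mem_basicOpen_iff.1 hl).2, hc.eventually (Arrow.mem_basicOpen_iff.1 hm).2]
    with z hz hz'
  simp [hz, hz']

theorem arrMap_inv (γ : Arrow V) : r.arrMap γ.inv = (r.arrMap γ).inv := by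
  obtain ⟨l, hl⟩ := r.exists_mem_P γ
  obtain ⟨m, hm⟩ := r.exists_mem_P γ.inv
  -- This `k` represents the unit germ: (c) identifies `ν(m) ∘ ν(l)` with `ν(k)`, and (d) identifies
  -- `ν(k)` with the identity.
  obtain ⟨k, hk⟩ := r.exists_mem_P (Arrow.unit γ.src)
  have hk' := Arrow.mk_mem_basicOpen.1 hk
  have hm' := Arrow.mk_mem_basicOpen.1 hm
  have hlx : l.1 γ.src = γ.tgt := (Arrow.tgt_eq_of_mem_basicOpen hl).symm
  have e : m.1 ∘ l.1 =ᶠ[𝓝 γ.src] id := by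
    have hc := l.1.continuousAt hl.1
    rw [ContinuousAt, hlx] at hc
    filter_upwards [(Arrow.mem_basicOpen_iff.1 hl).2, hc.eventually hm'.2,
      γ.rep.open_source.mem_nhds γ.src_mem_rep] with z hz hz' hzs
    rw [Function.comp_apply, ← hz', ← hz, γ.rep.left_inv hzs, id]
  have e' := (r.germ_mul l m k γ.src hl.1 (by rw [hlx]; exact hm'.1) hk'.1
    (e.trans hk'.2)).trans (r.germ_unit k γ.src hk'.1 hk'.2.symm)
  have ht := r.isGermOf_arrMap hm
  refine ht.unique ?_
  have hts : r.psi γ.inv.src = (r.arrMap γ).tgt := (r.tgt_arrMap γ).symm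
  rw [hts] at ht ⊢
  exact (r.isGermOf_arrMap hl).inv e' ht.mem_source

/-- The homomorphism induced by a representative of an orbifold map. -/
def toGpdHom : GpdHom V V' where
  obj := r.psi
  arr := r.arrMap
  obj_smooth := r.contMDiff_psi
  arr_smooth := r.contMDiff_arrMap
  map_src := r.src_arrMap
  map_tgt := r.tgt_arrMap
  map_unit := r.arrMap_unit
  map_mul := r.arrMap_mul
  map_inv := r.arrMap_inv

theorem induces_toGpdHom : r.Induces r.toGpdHom :=
  ⟨rfl, fun _ _ hx ↦ r.isGermOf_arrMap (Arrow.mk_mem_basicOpen.2 ⟨hx, .rfl⟩)⟩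

variable {r}

theorem Induces.isGermOf {φ : GpdHom V V'} (h : r.Induces φ) {γ : Arrow V} {l : r.P}
    (hγ : γ ∈ Arrow.basicOpen l.1) : IsGermOf hV' (φ.arr γ) (r.psi γ.src) (r.nu l) := by
  have := h.2 l γ.src hγ.1
  rw [h.1] at this
  rwa [Arrow.eq_mk_of_mem_basicOpen (r.changes l.1 l.2).1 hγ]

theorem Induces.unique {φ φ' : GpdHom V V'} (h : r.Induces φ) (h' : r.Induces φ') : φ = φ' := by
  refine GpdHom.ext (h.1.trans h'.1.symm) (funext fun γ ↦ ?_)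
  obtain ⟨l, hl⟩ := r.exists_mem_P γ
  exact (h.isGermOf hl).unique (h'.isGermOf hl)

/-- The condition on `f` is automatic, since the lifts cover `f`. -/
theorem isInducedBy_iff_induces {φ : GpdHom V V'} : r.IsInducedBy φ ↔ r.Induces φ := by
  refine ⟨fun h ↦ ⟨funext fun x ↦ (h.2.1 x.1 x.2).symm, h.2.2⟩, fun h ↦ ⟨?_, fun i x ↦ ?_, h.2⟩⟩
  · rintro ⟨x⟩
    change r.toFun (x.1.1.proj x.2) = (φ.obj x).proj
    rw [h.1, ← r.lift_proj]
    rfl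
  · rw [h.1]; rfl

theorem Induces.of_equivalent {r' : OrbMapRep V V' 𝒰' hV'} {φ : GpdHom V V'} (h : r.Induces φ)
    (e : Equivalent r r') : r'.Induces φ := by
  refine ⟨h.1.trans e.2.1, fun l x hx ↦ ?_⟩
  set γ := Arrow.mk l.1 (r'.changes l.1 l.2).1 x hx
  obtain ⟨m, hm⟩ := r.exists_mem_P γ
  have hm' := Arrow.mk_mem_basicOpen.1 hm
  have := (h.isGermOf hm).congr (e.2.2 m l x ⟨hm'.1, hx⟩ hm'.2.symm) (by
    change Total.incl hV' (r.psi x) ∈ _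
    rw [e.2.1]
    exact (r'.invariant l x hx).1)
  rw [h.1]
  exact this

/-- The charts cover `Q`, so `ψ` determines `f`; the arrow `φ₁ (germ_x λ)` determines the germ of
`ν(λ)` at `ψ(x)`. -/
theorem Induces.equivalent {r' : OrbMapRep V V' 𝒰' hV'} {φ : GpdHom V V'} (hV : IsAtlas V)
    (h : r.Induces φ) (h' : r'.Induces φ) : Equivalent r r' := by
  have hpsi : r.psi = r'.psi := h.1.symm.trans h'.1
  refine ⟨funext fun q ↦ ?_, hpsi, fun l l' x hx hl ↦ ?_⟩
  · obtain ⟨c, hc, x, rfl⟩ := hV.2 q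
    have := congrArg Total.proj (congrFun hpsi ⟨⟨c, hc⟩, x⟩)
    exact (r.lift_proj ⟨c, hc⟩ x).symm.trans (this.trans (r'.lift_proj ⟨c, hc⟩ x))
  · have h1 := h.2 l x hx.1
    have h2 := h'.2 l' x hx.2
    rw [Arrow.mk_eq_mk (hg := (r.changes l.1 l.2).1) (hx' := hx.1) |>.2 hl.symm, h.1] at h2
    rw [h.1] at h1
    exact h1.eventuallyEq h2

end OrbMapRep

/-! ### Transitions between single charts -/

section Extend

variable {n : ℕ} {Q : Type v} [TopologicalSpace Q] {V : Set (OrbChart.{u} n Q)}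

/-- A partial homeomorphism between two charts, regarded as one of the disjoint union. -/
def Total.extend (c d : V) (k : OpenPartialHomeomorph c.1.carrier d.1.carrier) :
    OpenPartialHomeomorph (Total V) (Total V) :=
  ((Total.mkHomeo c).symm.trans k).trans (Total.mkHomeo d)

variable {c d : V} {k : OpenPartialHomeomorph c.1.carrier d.1.carrier}

@[simp]
theorem Total.extend_mk (z : c.1.carrier) : Total.extend c d k ⟨c, z⟩ = ⟨d, k z⟩ := by
  simp [Total.extend]

theorem Total.extend_source : (Total.extend c d k).source = Sigma.mk c '' k.source := by
  ext x
  simp only [Total.extend, OpenPartialHomeomorph.trans_source, OpenPartialHomeomorph.symm_source,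
    Total.mkHomeo_source, preimage_univ, inter_univ, mem_inter_iff, Total.mem_mkHomeo_target]
  constructor
  · obtain ⟨e, z⟩ := x
    rintro ⟨rfl, hz⟩
    exact ⟨z, by simpa using hz, rfl⟩
  · rintro ⟨z, hz, rfl⟩
    exact ⟨rfl, by simpa using hz⟩

theorem Total.extend_mem_Psi (hk : IsDiffeo n k) (hp : ∀ z ∈ k.source, d.1.proj (k z) = c.1.proj z) :
    Total.extend c d k ∈ Psi V := by
  refine ⟨((Total.isDiffeo_mkHomeo c).symm.trans hk).trans (Total.isDiffeo_mkHomeo d), ?_⟩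
  intro x hx
  rw [Total.extend_source] at hx
  obtain ⟨z, hz, rfl⟩ := hx
  rw [Total.extend_mk]
  exact hp z hz

/-- The arrow is the germ of a compatibility diffeomorphism; this is the injectivity of the marking.
-/
theorem IsAtlas.exists_arrow (hV : IsAtlas V) {x y : Total V} (h : x.proj = y.proj) :
    ∃ γ : Arrow V, γ.src = x ∧ γ.tgt = y := by
  obtain ⟨c, x⟩ := x
  obtain ⟨d, y⟩ := y
  obtain ⟨k, hk, -, hx, hy, hp⟩ := hV.1 c.1 c.2 d.1 d.2 x y h
  refine ⟨Arrow.mk (Total.extend c d k) (Total.extend_mem_Psi hk hp) ⟨c, x⟩ ?_, rfl, ?_⟩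
  · rw [Total.extend_source]
    exact mem_image_of_mem _ hx
  · change Total.extend c d k ⟨c, x⟩ = ⟨d, y⟩
    rw [Total.extend_mk, hy]

theorem Total.continuous_proj : Continuous (Total.proj : Total V → Q) :=
  continuous_sigma fun c ↦ c.1.continuous_proj

theorem Total.isOpenMap_proj : IsOpenMap (Total.proj : Total V → Q) :=
  isOpenMap_sigma.2 fun c ↦ c.1.isOpenMap_proj

theorem IsAtlas.surjective_proj (hV : IsAtlas V) :
    Function.Surjective (Total.proj : Total V → Q) := by
  intro q
  obtain ⟨c, hc, x, rfl⟩ := hV.2 q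
  exact ⟨⟨⟨c, hc⟩, x⟩, rfl⟩

instance Total.locallyConnectedSpace : LocallyConnectedSpace (Total V) :=
  ChartedSpace.locallyConnectedSpace (EuclideanSpace ℝ (Fin n)) (Total V)

/-- Every arrow is the germ of a transition that is the restriction of an open embedding of
orbifold charts. -/
theorem Arrow.exists_isEmbeddingOfCharts {𝒰 : OrbStructure.{u} n Q} (hV : V ⊆ 𝒰.charts)
    (γ : Arrow V) : ∃ f ∈ Psi V, γ ∈ Arrow.basicOpen f ∧ ∃ g ∈ Psi 𝒰.charts,
      IsEmbeddingOfCharts 𝒰 g ∧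
      ∀ y ∈ f.source, Total.incl hV y ∈ g.source ∧ Total.incl hV (f y) = g (Total.incl hV y) := by
  obtain ⟨c, y, hy⟩ : ∃ (c : V) (y : c.1.carrier), γ.src = ⟨c, y⟩ := ⟨_, _, rfl⟩
  obtain ⟨d, hd⟩ : ∃ d : V, γ.tgt.1 = d := ⟨_, rfl⟩
  -- The representative of the arrow, read as a map from the chart of its source to the chart of its
  -- target. Its restriction to a stable `s` yields both `f`, on `∐ V`, and `g`, on all charts of
  -- `𝒰`.
  set k := ((Total.mkHomeo c).trans γ.rep).trans (Total.mkHomeo d).symm with hk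
  have hkd : IsDiffeo n k := ((Total.isDiffeo_mkHomeo c).trans γ.rep_mem.1).trans
    (Total.isDiffeo_mkHomeo d).symm
  have hks : ∀ z, z ∈ k.source ↔ (⟨c, z⟩ : Total V) ∈ γ.rep.source ∧ (γ.rep ⟨c, z⟩).1 = d := by
    intro z
    simp [hk, Total.mem_mkHomeo_target]
  have hkr : ∀ z ∈ k.source, (⟨d, k z⟩ : Total V) = γ.rep ⟨c, z⟩ := fun z hz ↦
    (Total.mkHomeo d).right_inv (Total.mem_mkHomeo_target.2 ((hks z).1 hz).2)
  have hkp : ∀ z ∈ k.source, d.1.proj (k z) = c.1.proj z := fun z hz ↦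
    (congrArg Total.proj (hkr z hz)).trans (γ.rep_mem.2 _ ((hks z).1 hz).1)
  have hyk : y ∈ k.source := by
    rw [hks, ← hy, γ.rep_src]
    exact ⟨γ.src_mem_rep, hd⟩
  obtain ⟨s, hys, hsk, hconn, hs⟩ := c.1.exists_stable_nhd y k.open_source hyk
  have hsrc : (k.restrOpen s s.isOpen).source = s := by
    rw [k.restrOpen_source]; exact inter_eq_right.2 hsk
  have hkp' : ∀ z ∈ (k.restrOpen s s.isOpen).source,
      d.1.proj (k.restrOpen s s.isOpen z) = c.1.proj z := fun z hz ↦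
    hkp z (hsk (hsrc ▸ hz))
  have hf := Total.extend_mem_Psi (hkd.restrOpen s.isOpen) hkp'
  refine ⟨Total.extend c d (k.restrOpen s s.isOpen), hf, ?_,
    Total.extend (V := 𝒰.charts) ⟨c.1, hV c.2⟩ ⟨d.1, hV d.2⟩ (k.restrOpen s s.isOpen),
    Total.extend_mem_Psi (hkd.restrOpen s.isOpen) hkp', ?_, ?_⟩
  · have hmem : γ.src ∈ (Total.extend c d (k.restrOpen s s.isOpen)).source := by
      rw [hy, Total.extend_source, hsrc]
      exact mem_image_of_mem _ hys
    refine Arrow.mem_basicOpen_iff.2 ⟨hmem, ?_⟩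
    filter_upwards [(Total.extend c d (k.restrOpen s s.isOpen)).open_source.mem_nhds hmem] with z hz
    rw [Total.extend_source, hsrc] at hz
    obtain ⟨z, hz, rfl⟩ := hz
    rw [Total.extend_mk]
    exact (hkr z (hsk hz)).symm
  · have hne : Nonempty s := ⟨⟨y, hys⟩⟩
    refine ⟨⟨c.1.sub s hconn hs, 𝒰.sub_mem (hV c.2) s hconn hs⟩, ⟨c.1, hV c.2⟩, ⟨d.1, hV d.2⟩,
      fun z : s ↦ z.1, fun z : s ↦ k z.1, ⟨Subtype.val_injective, ?_, fun _ ↦ rfl⟩,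
      ⟨?_, ?_, fun z : s ↦ hkp z (hsk z.2)⟩, ?_, ?_⟩
    · exact fun z ↦ (isDiffeo_subtypeCoe s hne).isLocalDiffeomorphAt (mem_univ z)
    · exact fun z w hzw ↦ Subtype.ext (k.injOn (hsk z.2) (hsk w.2) hzw)
    · exact fun z : s ↦ ((isDiffeo_subtypeCoe s hne).trans hkd).isLocalDiffeomorphAt (x := z) (by
        rw [OpenPartialHomeomorph.trans_source]
        exact ⟨mem_univ z, hsk z.2⟩)
    · rw [Total.extend_source, hsrc, image_eq_range]
      rfl
    · intro z
      rw [Total.extend_mk]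
      rfl
  · intro z hz
    rw [Total.extend_source, hsrc] at hz
    obtain ⟨z, hz, rfl⟩ := hz
    rw [Total.extend_source, hsrc]
    refine ⟨⟨z, hz, rfl⟩, ?_⟩
    rw [Total.extend_mk]
    exact (Total.extend_mk (V := 𝒰.charts) (c := ⟨c.1, hV c.2⟩) (d := ⟨d.1, hV d.2⟩)
      (k := k.restrOpen s s.isOpen) z).symm

end Extend

/-! ### Generation of `Ψ(V)` -/

section Generation

variable {n : ℕ} {Q : Type v} [TopologicalSpace Q] {V : Set (OrbChart.{u} n Q)}

theorem isGluingPseudogroup_Psi (V : Set (OrbChart.{u} n Q)) : IsGluingPseudogroup n (Psi V) where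
  diffeo _ hf := hf.1
  congr f hf g h := ⟨hf.1.congr h, fun x hx ↦ by
    rw [← h.source_eq] at hx
    rw [← h.eqOn hx]
    exact hf.2 x hx⟩
  trans _ hf _ hg := trans_mem_Psi hf hg
  symm _ hf := symm_mem_Psi hf
  restr _ hf _ hs := restrOpen_mem_Psi hf hs
  glue f hf H := ⟨hf, fun x hx ↦ by
    obtain ⟨s, hs, hxs, h⟩ := H x hx
    exact h.2 x (by rw [f.restrOpen_source]; exact ⟨hx, hxs⟩)⟩

variable {P : Set (OpenPartialHomeomorph (Total V) (Total V))}

/-- Here `P` contains actual restrictions of `f` around each point, not just its germs, so the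
gluing property puts `f` in any competing `A`. Conversely, elements of `A` agree near each point
with elements of `P`, hence commute with `π`. -/
theorem generates_Psi (hP : P ⊆ Psi V) (H : ∀ f ∈ Psi V, ∀ x ∈ f.source,
    ∃ l ∈ P, x ∈ l.source ∧ l.source ⊆ f.source ∧ EqOn f l l.source) : Generates n P (Psi V) := by
  refine ⟨isGluingPseudogroup_Psi V, ⟨hP, fun f hf x hx ↦ ?_⟩, fun A hA hAP ↦ ?_⟩
  · obtain ⟨l, hl, hxl, hlf, he⟩ := H f hf x hx
    exact ⟨l, hl, hxl, l.source, l.open_source, hxl, subset_inter hlf subset_rfl, he⟩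
  · refine Subset.antisymm (fun f hf ↦ ⟨hA.diffeo f hf, fun x hx ↦ ?_⟩) fun f hf ↦
      hA.glue f hf.1 fun x hx ↦ ?_
    · obtain ⟨l, hl, hxl, s, -, hxs, -, he⟩ := hAP.2 f hf x hx
      rw [he hxs]
      exact (hP hl).2 x hxl
    · obtain ⟨l, hl, hxl, hlf, he⟩ := H f hf x hx
      refine ⟨l.source, l.open_source, hxl, hA.congr l (hAP.1 hl) _ ⟨?_, fun z hz ↦ (he hz).symm⟩⟩
      exact (inter_eq_right.2 hlf).symm

theorem isQuasiPseudogroup_of_forall_exists (hP : P ⊆ Psi V) (H : ∀ f ∈ Psi V, ∀ x ∈ f.source,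
    ∃ l ∈ P, x ∈ l.source ∧ l.source ⊆ f.source ∧ EqOn f l l.source) :
    IsQuasiPseudogroup n P where
  diffeo f hf := (hP hf).1
  inv f hf x hx := by
    obtain ⟨g, hg, hxg, hgf, he⟩ := H f.symm (symm_mem_Psi (hP hf)) (f x) (f.map_source hx)
    -- With this choice the inverse of the restricted `f` has domain exactly `g.source`.
    refine ⟨f.source ∩ f ⁻¹' g.source, f.isOpen_inter_preimage g.open_source, ⟨hx, hxg⟩,
      inter_subset_left, g, hg, g.source, g.open_source, hxg, subset_rfl, ?_, fun y hy ↦ ?_⟩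
    · ext y
      constructor
      · rintro ⟨h1, h2⟩
        have h3 : f (f.symm y) ∈ g.source := h2.2
        rw [f.right_inv h1] at h3
        exact ⟨h3, h3⟩
      · rintro ⟨h1, -⟩
        have h2 : y ∈ f.target := hgf h1
        refine ⟨h2, f.map_target h2, ?_⟩
        change f (f.symm y) ∈ g.source
        rwa [f.right_inv h2]
    · have h2 : f (f.symm y) ∈ g.source := hy.2.2
      rw [f.right_inv hy.1] at h2
      exact he h2
  comp f hf g hg x hx hfx := by
    obtain ⟨l, hl, hxl, hlf, he⟩ := H (f.trans g) (trans_mem_Psi (hP hf) (hP hg)) x (by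
      rw [OpenPartialHomeomorph.trans_source]; exact ⟨hx, hfx⟩)
    exact ⟨l, hl, hxl, l.source, l.open_source, hxl, subset_inter hlf subset_rfl, he⟩

end Generation

/-! ### The orbifold map induced by a homomorphism -/

namespace GpdHom

open OrbMapRep

variable {n n' : ℕ} {Q : Type v} [TopologicalSpace Q] {Q' : Type t} [TopologicalSpace Q']
  {V : Set (OrbChart.{u} n Q)} {V' : Set (OrbChart.{w} n' Q')} {𝒰' : OrbStructure.{w} n' Q'}
  (φ : GpdHom V V') (hV' : V' ⊆ 𝒰'.charts)

/-- The changes of charts `λ` for which a single open embedding of orbifold charts has the germs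
`φ₁ (germ_x λ)` for all `x ∈ dom λ`. -/
def liftable : Set (OpenPartialHomeomorph (Total V) (Total V)) :=
  {l | IsChangeOfCharts V l ∧ ∃ g ∈ Psi 𝒰'.charts, IsEmbeddingOfCharts 𝒰' g ∧
    ∀ (hl : l ∈ Psi V) (x : Total V) (hx : x ∈ l.source),
      IsGermOf hV' (φ.arr (Arrow.mk l hl x hx)) (φ.obj x) g}

theorem liftable_subset_Psi : φ.liftable hV' ⊆ Psi V := fun _ hl ↦ hl.1.1

/-- Continuity of `φ₁` is the key: an arrow near `germ_x f` is sent into the open set of germs of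
the one transition `f'` chosen at `x`, hence to a germ of the one embedding `g`. -/
theorem exists_mem_liftable {f : OpenPartialHomeomorph (Total V) (Total V)} (hf : f ∈ Psi V)
    {x : Total V} (hx : x ∈ f.source) :
    ∃ l ∈ φ.liftable hV', x ∈ l.source ∧ l.source ⊆ f.source ∧ EqOn f l l.source := by
  obtain ⟨f', hf', hγ, g, hg, hge, hfg⟩ :=
    Arrow.exists_isEmbeddingOfCharts hV' (φ.arr (Arrow.mk f hf x hx))
  -- The points `z` of `dom f` at which `φ₁ (germ_z f)` is a germ of `f'`.
  set S := f.source ∩ (Arrow.germChart f hf).symm ⁻¹' (φ.arr ⁻¹' Arrow.basicOpen f') with hS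
  have hSo : IsOpen S := (Arrow.germChart f hf).isOpen_inter_preimage_symm
    ((Arrow.isOpen_basicOpen hf').preimage φ.arr_smooth.continuous)
  have hSmem : ∀ z (hz : z ∈ f.source),
      z ∈ S ↔ φ.arr (Arrow.mk f hf z hz) ∈ Arrow.basicOpen f' := by
    intro z hz
    rw [hS, mem_inter_iff, mem_preimage, Arrow.germChart_symm_apply hf hz]
    exact and_iff_right hz
  -- Cutting down to one chart at each end, and then to a connected component, makes the restriction
  -- a change of charts.
  set T := S ∩ ({z | z.1 = x.1} ∩ (f.source ∩ f ⁻¹' {z | z.1 = (f x).1})) with hT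
  have hTo : IsOpen T := hSo.inter ((Total.isOpen_fst_eq x.1).inter
    (f.isOpen_inter_preimage (Total.isOpen_fst_eq (f x).1)))
  have hxT : x ∈ T := ⟨(hSmem x hx).2 hγ, rfl, hx, rfl⟩
  have hCo : IsOpen (connectedComponentIn T x) := hTo.connectedComponentIn
  have hCT := connectedComponentIn_subset T x
  have hsrc : (f.restrOpen _ hCo).source = connectedComponentIn T x := by
    rw [f.restrOpen_source]
    exact inter_eq_right.2 fun z hz ↦ (hCT hz).1.1
  have hxl : x ∈ (f.restrOpen _ hCo).source := by
    rw [hsrc]; exact mem_connectedComponentIn hxT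
  refine ⟨f.restrOpen _ hCo, ⟨⟨restrOpen_mem_Psi hf hCo, ?_, x.1, (f x).1, fun z hz ↦ ?_,
    fun y hy ↦ ?_⟩, g, hg, hge, fun hl z hz ↦ ?_⟩, hxl, ?_, fun _ _ ↦ rfl⟩
  · rw [hsrc]; exact isConnected_connectedComponentIn_iff.2 hxT
  · rw [hsrc] at hz; exact (hCT hz).2.1
  · have h1 := (f.restrOpen _ hCo).map_target hy
    rw [hsrc] at h1
    have h2 := (hCT h1).2.2.2
    have h3 : f ((f.restrOpen _ hCo).symm y) = y := (f.restrOpen _ hCo).right_inv hy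
    rw [mem_preimage, h3] at h2
    exact h2
  · have hzC := hz
    rw [hsrc] at hzC
    have hzf := (hCT hzC).1.1
    have h1 := (hSmem z hzf).1 (hCT hzC).1
    have h2 : Arrow.mk (f.restrOpen _ hCo) hl z hz = Arrow.mk f hf z hzf :=
      Arrow.mk_eq_mk.2 .rfl
    rw [h2]
    refine isGermOf_iff.2 ⟨φ.map_src _, (hfg _ h1.1).1, ?_⟩
    filter_upwards [(Arrow.mem_basicOpen_iff.1 h1).2, f'.open_source.mem_nhds h1.1] with w hw hws
    rw [Function.comp_apply, hw]
    exact (hfg w hws).2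
  · rw [hsrc]; exact fun z hz ↦ (hCT hz).1.1

theorem proj_obj_eq (hV : IsAtlas V) {x y : Total V} (h : x.proj = y.proj) :
    (φ.obj x).proj = (φ.obj y).proj := by
  obtain ⟨γ, rfl, rfl⟩ := hV.exists_arrow h
  rw [← φ.map_src, ← φ.map_tgt, ← (φ.arr γ).rep_src]
  exact ((φ.arr γ).rep_mem.2 _ (φ.arr γ).src_mem_rep).symm

/-- Points in one fibre of `π` are joined by an arrow, so `π' ∘ φ₀` is constant on fibres; it
descends continuously because `π` is an open surjection, hence a quotient map. -/
theorem exists_continuous_proj (hV : IsAtlas V) :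
    ∃ f : Q → Q', Continuous f ∧ ∀ x : Total V, f x.proj = (φ.obj x).proj := by
  choose σ hσ using hV.surjective_proj
  have h : ∀ x : Total V, (φ.obj (σ x.proj)).proj = (φ.obj x).proj := fun x ↦
    φ.proj_obj_eq hV (hσ _)
  refine ⟨fun q ↦ (φ.obj (σ q)).proj, ?_, h⟩
  have hq : IsQuotientMap (Total.proj : Total V → Q) :=
    Total.isOpenMap_proj.isQuotientMap Total.continuous_proj hV.surjective_proj
  rw [hq.continuous_iff]
  exact (Total.continuous_proj.comp φ.obj_smooth.continuous).congr fun x ↦ (h x).symm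

/-- A chart is connected, so its image under `φ₀` stays in one summand of `∐ V'`. -/
theorem exists_lift (c : V) : ∃ (d : V') (k : c.1.carrier → d.1.carrier),
    ContMDiff (𝓡 n) (𝓡 n') ∞ k ∧ ∀ x, φ.obj ⟨c, x⟩ = ⟨d, k x⟩ := by
  have hsm : ContMDiff (𝓡 n) (𝓡 n') ∞ fun x : c.1.carrier ↦ φ.obj ⟨c, x⟩ := fun x ↦
    (φ.obj_smooth _).comp x ((Total.isDiffeo_mkHomeo c).1.contMDiffAt univ_mem)
  obtain ⟨d, k, -, hk⟩ := hsm.continuous.exists_lift_sigma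
  have hk' : ∀ x, φ.obj ⟨c, x⟩ = ⟨d, k x⟩ := congrFun hk
  refine ⟨d, k, fun x ↦ ?_, hk'⟩
  have h1 := (Total.isDiffeo_mkHomeo d).2.contMDiffAt (x := φ.obj ⟨c, x⟩)
    ((Total.mkHomeo d).open_target.mem_nhds (Total.mem_mkHomeo_target.2 (by rw [hk'])))
  refine (h1.comp x (hsm x)).congr_of_eventuallyEq (Eventually.of_forall fun z ↦ ?_)
  simp [hk']

theorem exists_induces (hV : IsAtlas V) : ∃ r : OrbMapRep V V' 𝒰' hV', r.Induces φ := by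
  obtain ⟨f, hf, hfp⟩ := φ.exists_continuous_proj hV
  choose d k hk hφ using φ.exists_lift
  have hobj : ∀ x : Total V, (⟨d x.1, k x.1 x.2⟩ : Total V') = φ.obj x := fun x ↦ (hφ x.1 x.2).symm
  choose ν hν hνe hνg using fun l : φ.liftable hV' ↦ l.2.2
  have hP := φ.liftable_subset_Psi hV'
  have H := fun f hf x hx ↦ φ.exists_mem_liftable hV' (f := f) hf (x := x) hx
  refine ⟨{ toFun := f
            continuous_toFun := hf
            rangeChart := d
            lift := k
            lift_smooth := hk
            lift_proj := fun i x ↦ ?_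
            P := φ.liftable hV'
            quasi := isQuasiPseudogroup_of_forall_exists hP H
            changes := fun l hl ↦ hl.1
            generates := generates_Psi hP H
            nu := ν
            nu_mem := hν
            nu_embedding := hνe
            invariant := fun l x hx ↦ ?_
            germ_congr := fun l m x hx h ↦ ?_
            germ_mul := fun l m h x hx hlx hxh e ↦ ?_
            germ_unit := fun l x hx h ↦ ?_ }, funext fun x ↦ (hobj x).symm,
          fun l x hx ↦ hνg l (hP l.2) x hx⟩
  · exact (congrArg Total.proj (hobj ⟨i, x⟩)).trans (hfp ⟨i, x⟩).symm
  · have h := hνg l (hP l.2) x hx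
    rw [hobj, hobj]
    refine ⟨h.mem_source, ?_⟩
    rw [← h.incl_tgt, φ.map_tgt]
    rfl
  · have h1 := hνg l (hP l.2) x hx.1
    have h2 := hνg m (hP m.2) x hx.2
    rw [hobj]
    rw [Arrow.mk_eq_mk (hg := hP m.2) (hx' := hx.2) |>.2 h] at h1
    exact h1.eventuallyEq h2
  · have h1 := hνg l (hP l.2) x hx
    have h2 := hνg m (hP m.2) _ hlx
    have h3 := hνg h (hP h.2) x hxh
    have h4 := h2.mul h1 (by rw [φ.map_src, φ.map_tgt]; rfl)
    -- Functoriality turns the product of the image arrows into `φ₁` of the germ of `m ∘ l`, which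
    -- is the germ of `h`.
    rw [← φ.map_mul _ _ rfl, Arrow.mul_mk,
      Arrow.mk_eq_mk (hg := hP h.2) (hx' := hxh) |>.2 (by simpa using e)] at h4
    rw [hobj]
    have h5 := h4.eventuallyEq h3
    rwa [OpenPartialHomeomorph.coe_trans] at h5
  · have h1 := hνg l (hP l.2) x hx
    rw [Arrow.mk_eq_mk (hg := refl_mem_Psi V) (hx' := mem_univ x) |>.2 h] at h1
    have h2 : IsGermOf hV' (φ.arr (Arrow.unit x)) (φ.obj x) (.refl (Total 𝒰'.charts)) := by
      rw [φ.map_unit]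
      exact isGermOf_unit _
    rw [hobj]
    exact h1.eventuallyEq h2

end GpdHom

end OrbGpd

end

/-! ### The two mutually inverse bijections. -/

theorem mainTheorem2 {n n' : ℕ} {Q Q' : Type*} [TopologicalSpace Q] [TopologicalSpace Q']
    (𝒰 : OrbGpd.OrbStructure n Q) (𝒰' : OrbGpd.OrbStructure n' Q')
    (V : Set (OrbGpd.OrbChart n Q)) (V' : Set (OrbGpd.OrbChart n' Q'))
    (hV : OrbGpd.IsRepresentative V 𝒰) (hV' : OrbGpd.IsRepresentative V' 𝒰') :
    ∃ (F₁ : OrbGpd.Orbmap V V' 𝒰' hV'.2 → OrbGpd.GpdHom V V')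
      (F₂ : OrbGpd.GpdHom V V' → OrbGpd.Orbmap V V' 𝒰' hV'.2),
      (∀ (r : OrbGpd.OrbMapRep V V' 𝒰' hV'.2) (φ : OrbGpd.GpdHom V V'),
        F₁ r.toOrbmap = φ ↔ r.Induces φ) ∧
      (∀ (φ : OrbGpd.GpdHom V V') (r : OrbGpd.OrbMapRep V V' 𝒰' hV'.2),
        F₂ φ = r.toOrbmap ↔ r.IsInducedBy φ) ∧
      Function.Bijective F₁ ∧ Function.Bijective F₂ ∧
      Function.LeftInverse F₂ F₁ ∧ Function.RightInverse F₂ F₁ := by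
  choose R hR using fun φ : OrbGpd.GpdHom V V' ↦ φ.exists_induces hV'.2 hV.1
  have hlift : ∀ r s : OrbGpd.OrbMapRep V V' 𝒰' hV'.2, r.Equivalent s →
      r.toGpdHom = s.toGpdHom := fun r s h ↦
    (r.induces_toGpdHom.of_equivalent h).unique s.induces_toGpdHom
  let F₁ : OrbGpd.Orbmap V V' 𝒰' hV'.2 → OrbGpd.GpdHom V V' :=
    Quotient.lift (s := OrbGpd.OrbMapRep.setoid V V' 𝒰' hV'.2) (fun r ↦ r.toGpdHom) hlift
  let F₂ : OrbGpd.GpdHom V V' → OrbGpd.Orbmap V V' 𝒰' hV'.2 := fun φ ↦ (R φ).toOrbmap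
  have h₁ : ∀ (r : OrbGpd.OrbMapRep V V' 𝒰' hV'.2) (φ : OrbGpd.GpdHom V V'),
      F₁ r.toOrbmap = φ ↔ r.Induces φ := by
    refine fun r φ ↦ ⟨?_, fun h ↦ r.induces_toGpdHom.unique h⟩
    rintro rfl
    exact r.induces_toGpdHom
  have hr : Function.RightInverse F₂ F₁ := fun φ ↦ (h₁ (R φ) φ).2 (hR φ)
  have hl : Function.LeftInverse F₂ F₁ := by
    rintro ⟨r⟩
    exact Quotient.sound (s := OrbGpd.OrbMapRep.setoid V V' 𝒰' hV'.2)
      ((hR r.toGpdHom).equivalent hV.1 r.induces_toGpdHom)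
  refine ⟨F₁, F₂, h₁, fun φ r ↦ ?_, ⟨hl.injective, hr.surjective⟩, ⟨hr.injective, hl.surjective⟩,
    hl, hr⟩
  -- The description of `F₂` is that of `F₁` transported along the bijection.
  rw [OrbGpd.OrbMapRep.isInducedBy_iff_induces, ← h₁]
  exact ⟨fun h ↦ h ▸ hr φ, fun h ↦ h ▸ hl _⟩
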